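/- Let $d\ge 0$ and let $\mathscr E=\mathscr E(\mathbb R^d,0)$ be the $\mathbb R$-algebra of germs at the origin of $C^\infty$-smooth functions $\mathbb R^d\to\mathbb R$. Let $\operatorname{Diff}(\mathbb R^d,0)$ be the group, under composition, of invertible germs of $C^\infty$-smooth self-maps of $(\mathbb R^d,0)$; for such a germ $g$ put $g^*f=f\circ g$ for $f\in\mathscr E$. A subgroup $G\subseteq\operatorname{Diff}(\mathbb R^d,0)$ is called finitely generated if there are finitely many germs $F_1,\dots,F_p\in\operatorname{Diff}(\mathbb R^d,0)$ and finitely many germs of $C^\infty$-smooth vector fields $v_1,\dots,v_q$ vanishing at the origin (the cases $p=0$ or $q=0$ are not excluded) such that $G$ is generated by $F_1,\dots,F_p$ and all the flow maps $\mathrm e^{tv_j}$, $t\in\mathbb R$, $j=1,\dots,q$. A finitely presented local subvariety $X$ of $(\mathbb R^d,0)$ is the germ of the common zero locus of a finitely generated ideal $I_X\subseteq\mathscr E$. The multiplicity of the intersection of $g^{-1}(X)$ and $Y$ is $$\mu(g)=\mu(g^{-1}(X),Y)=\operatorname{codim}_{\mathbb R}\langle g^*I_X,\,I_Y\rangle=\dim_{\mathbb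 R}\mathscr E/\langle g^*I_X,\,I_Y\rangle\in\mathbb N\cup\{+\infty\}.$$ **Statement.** Let $G\subseteq\operatorname{Diff}(\mathbb R^d,0)$ be a commutative finitely generated subgroup, and let $X,Y\subseteq(\mathbb R^d,0)$ be finitely presented local subvarieties, given by finitely generated ideals $I_X,I_Y\subseteq\mathscr E$. Then the finite values of the multiplicity are bounded: there is a constant $m\in\mathbb N$, depending on $G$, $I_X$ and $I_Y$, such that for every $g\in G$ $$\mu(g)<+\infty\ \Longrightarrow\ \mu(g)\le m .$$ The same assertion holds, with a constant $m$ depending on $G$, $X$ and $Y$, if in the definition of the multiplicity the ideals $g^*I_X$ and $I_Y$ are replaced by the (not necessarily finitely generated) ideals of all germs in $\mathscr E$ vanishing on $g^{-1}(X)$ and on $Y$, respectively. -/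

import Mathlib

open Filter Topology
open scoped ContDiff

noncomputable section

namespace SmoothLocal

/-- The source space `ℝ^d`. -/
abbrev E (d : ℕ) : Type := Fin d → ℝ

/-- A germ at the origin of `ℝ^d` is `C^∞` if it has a representative that is `C^∞` at every point
of some neighbourhood of the origin. -/
def IsSmooth {d : ℕ} {W : Type*} [NormedAddCommGroup W] [NormedSpace ℝ W]
    (φ : Germ (𝓝 (0 : E d)) W) : Prop :=
  ∃ f : E d → W, (∀ᶠ x in 𝓝 (0 : E d), ContDiffAt ℝ ∞ f x) ∧ (f : Germ (𝓝 (0 : E d)) W) = φ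

/-- The ring of germs at `0` of `C^∞` functions `ℝ^d → ℝ`. -/
def smoothGermSubring (d : ℕ) : Subring (Germ (𝓝 (0 : E d)) ℝ) where
  carrier := {φ | IsSmooth φ}
  mul_mem' := by
    rintro _ _ ⟨f, hf, rfl⟩ ⟨g, hg, rfl⟩
    exact ⟨f * g, by filter_upwards [hf, hg] with x h1 h2 using h1.mul h2, rfl⟩
  one_mem' := ⟨1, Eventually.of_forall fun _ => contDiffAt_const, rfl⟩
  add_mem' := by
    rintro _ _ ⟨f, hf, rfl⟩ ⟨g, hg, rfl⟩
    exact ⟨f + g, by filter_upwards [hf, hg] with x h1 h2 using h1.add h2, rfl⟩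
  zero_mem' := ⟨0, Eventually.of_forall fun _ => contDiffAt_const, rfl⟩
  neg_mem' := by
    rintro _ ⟨f, hf, rfl⟩
    exact ⟨-f, by filter_upwards [hf] with x h1 using h1.neg, rfl⟩

/-- The local ring `𝓔(ℝ^d, 0)` of germs of `C^∞` real functions. -/
abbrev SmoothGerm (d : ℕ) : Type := smoothGermSubring d

/-- Constants make `𝓔(ℝ^d, 0)` an `ℝ`-algebra. -/
instance instAlgebraSmoothGerm (d : ℕ) : Algebra ℝ (SmoothGerm d) :=
  RingHom.toAlgebra
    { toFun := fun c =>
        ⟨((fun _ => c : E d → ℝ) : Germ (𝓝 (0 : E d)) ℝ),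
          ⟨fun _ => c, Eventually.of_forall fun _ => contDiffAt_const, rfl⟩⟩
      map_one' := rfl
      map_mul' := fun _ _ => rfl
      map_zero' := rfl
      map_add' := fun _ _ => rfl }

/-- A germ of a self-map of `(ℝ^d, 0)`: smooth and fixing the origin. -/
def IsSelfMap {d : ℕ} (φ : Germ (𝓝 (0 : E d)) (E d)) : Prop :=
  ∃ f : E d → E d, (∀ᶠ x in 𝓝 (0 : E d), ContDiffAt ℝ ∞ f x) ∧ f 0 = 0 ∧
    (f : Germ (𝓝 (0 : E d)) (E d)) = φ

/-- Germs of `C^∞` self-maps `(ℝ^d, 0) → (ℝ^d, 0)`, not necessarily invertible. -/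
def SelfMapGerm (d : ℕ) : Type := {φ : Germ (𝓝 (0 : E d)) (E d) // IsSelfMap φ}

theorem tendsto_of_smooth {d : ℕ} {f : E d → E d}
    (hf : ∀ᶠ x in 𝓝 (0 : E d), ContDiffAt ℝ ∞ f x) (h0 : f 0 = 0) :
    Tendsto f (𝓝 (0 : E d)) (𝓝 (0 : E d)) := by
  have h := hf.self_of_nhds.continuousAt.tendsto
  rwa [h0] at h

theorem SelfMapGerm.tendsto {d : ℕ} (F : SelfMapGerm d) :
    F.1.Tendsto (𝓝 (0 : E d)) := by
  obtain ⟨_, f, hf, h0, rfl⟩ := F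
  exact tendsto_of_smooth hf h0

/-- Composition `φ ∘ F` of a germ at the origin with a germ of a self-map. -/
def SelfMapGerm.compGerm {d : ℕ} {W : Type*} (φ : Germ (𝓝 (0 : E d)) W) (F : SelfMapGerm d) :
    Germ (𝓝 (0 : E d)) W :=
  φ.compTendsto' F.1 F.tendsto

theorem eventually_contDiffAt_comp {d : ℕ} {W : Type*} [NormedAddCommGroup W] [NormedSpace ℝ W]
    {g : E d → W} {f : E d → E d} (hg : ∀ᶠ x in 𝓝 (0 : E d), ContDiffAt ℝ ∞ g x)
    (hf : ∀ᶠ x in 𝓝 (0 : E d), ContDiffAt ℝ ∞ f x) (h0 : f 0 = 0) :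
    ∀ᶠ x in 𝓝 (0 : E d), ContDiffAt ℝ ∞ (g ∘ f) x := by
  filter_upwards [hf, (tendsto_of_smooth hf h0).eventually hg] with x h1 h2
  exact h2.comp x h1

theorem IsSmooth.compGerm {d : ℕ} {W : Type*} [NormedAddCommGroup W] [NormedSpace ℝ W]
    {φ : Germ (𝓝 (0 : E d)) W} (hφ : IsSmooth φ) (F : SelfMapGerm d) :
    IsSmooth (SelfMapGerm.compGerm φ F) := by
  obtain ⟨g, hg, rfl⟩ := hφ
  obtain ⟨_, f, hf, h0, rfl⟩ := F
  exact ⟨g ∘ f, eventually_contDiffAt_comp hg hf h0, rfl⟩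

/-- Germs of smooth self-maps form a monoid; the product `F * H` is the composition `F ∘ H`. -/
instance instMonoidSelfMapGerm (d : ℕ) : Monoid (SelfMapGerm d) where
  one := ⟨((id : E d → E d) : Germ (𝓝 (0 : E d)) (E d)),
    ⟨id, Eventually.of_forall fun _ => contDiffAt_id, rfl, rfl⟩⟩
  mul F H := ⟨SelfMapGerm.compGerm F.1 H, by
    obtain ⟨_, f, hf, f0, rfl⟩ := F
    obtain ⟨_, h, hh, h0, rfl⟩ := H
    exact ⟨f ∘ h, eventually_contDiffAt_comp hf hh h0, by simp [f0, h0], rfl⟩⟩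
  mul_assoc := by
    rintro ⟨_, f, hf, f0, rfl⟩ ⟨_, h, hh, h0, rfl⟩ ⟨_, k, hk, k0, rfl⟩
    rfl
  one_mul := by
    rintro ⟨_, f, hf, f0, rfl⟩
    rfl
  mul_one := by
    rintro ⟨_, f, hf, f0, rfl⟩
    rfl

/-- `Diff(ℝ^d, 0)`: the group, under composition, of the invertible germs of `C^∞` self-maps. -/
abbrev DiffGerm (d : ℕ) : Type := (SelfMapGerm d)ˣ

/-- The pullback `F^* : 𝓔(ℝ^d, 0) → 𝓔(ℝ^d, 0)`, `φ ↦ φ ∘ F`. -/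
def pullback {d : ℕ} (F : SelfMapGerm d) : SmoothGerm d →+* SmoothGerm d where
  toFun φ := ⟨SelfMapGerm.compGerm φ.1 F, φ.2.compGerm F⟩
  map_one' := by
    obtain ⟨_, f, hf, f0, rfl⟩ := F
    rfl
  map_mul' := by
    obtain ⟨_, f, hf, f0, rfl⟩ := F
    rintro ⟨_, g, hg, rfl⟩ ⟨_, h, hh, rfl⟩
    rfl
  map_zero' := by
    obtain ⟨_, f, hf, f0, rfl⟩ := F
    rfl
  map_add' := by
    obtain ⟨_, f, hf, f0, rfl⟩ := F
    rintro ⟨_, g, hg, rfl⟩ ⟨_, h, hh, rfl⟩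
    rfl

/-- `φ` is the local flow near the equilibrium `0` of the vector field `v` (only the germ of `v` at
the origin matters): it is defined and `C^∞` in time and space jointly on a neighbourhood of
`ℝ × {0}`, it solves `∂φ/∂t = v ∘ φ` there, it is the identity at time zero and fixes the
origin. -/
structure IsLocalFlow {d : ℕ} (v : E d → E d) (φ : ℝ × E d → E d) : Prop where
  smooth : ∀ t : ℝ, ∀ᶠ p in 𝓝 (t, (0 : E d)), ContDiffAt ℝ ∞ φ p
  init : ∀ᶠ x in 𝓝 (0 : E d), φ (0, x) = x
  fixes : ∀ t : ℝ, φ (t, 0) = 0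
  ode : ∀ t : ℝ, ∀ᶠ p in 𝓝 (t, (0 : E d)),
    HasDerivAt (fun s : ℝ => φ (s, p.2)) (v (φ p)) p.1

/-- `g` is the germ at the origin of the time-`t` flow map `e^{tv}` of the vector field `v`. -/
def IsFlowMap {d : ℕ} (v : E d → E d) (t : ℝ) (g : DiffGerm d) : Prop :=
  ∃ φ : ℝ × E d → E d, IsLocalFlow v φ ∧
    ((fun x : E d => φ (t, x)) : Germ (𝓝 (0 : E d)) (E d)) = g.val.val

/-- A subgroup of `Diff(ℝ^d, 0)` is finitely generated if it is generated by finitely many germs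
`F i` together with all the flow maps `e^{t v j}`, `t ∈ ℝ`, of finitely many germs `v j` of `C^∞`
vector fields vanishing at the origin. -/
def IsFinitelyGenerated {d : ℕ} (G : Subgroup (DiffGerm d)) : Prop :=
  ∃ (p q : ℕ) (F : Fin p → DiffGerm d) (v : Fin q → E d → E d),
    (∀ j, (∀ᶠ x in 𝓝 (0 : E d), ContDiffAt ℝ ∞ (v j) x) ∧ v j 0 = 0) ∧
    G = Subgroup.closure (Set.range F ∪ {g | ∃ (j : Fin q) (t : ℝ), IsFlowMap (v j) t g})

/-- The codimension over `ℝ` of an ideal of `𝓔(ℝ^d, 0)`, in `ℕ ∪ {∞}`. -/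
def codim {d : ℕ} (K : Ideal (SmoothGerm d)) : ℕ∞ :=
  Cardinal.toENat (Module.rank ℝ (SmoothGerm d ⧸ K))

/-- The multiplicity of the intersection of `g⁻¹(X)` and `Y`, for the varieties `X` and `Y` with
ideals `I` and `J`; the ideal of `g⁻¹(X)` is `g^* I`. -/
def mult {d : ℕ} (I J : Ideal (SmoothGerm d)) (g : DiffGerm d) : ℕ∞ :=
  codim (I.map (pullback g.val) ⊔ J)

/-- Germs at the origin of subsets of `ℝ^d`, as germs of predicates; the order is inclusion. -/
abbrev SetGerm (d : ℕ) : Type := Germ (𝓝 (0 : E d)) Prop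

/-- The germ of the set of zeros of a germ of a function. -/
def zeroSet {d : ℕ} (φ : SmoothGerm d) : SetGerm d := Germ.map (fun y : ℝ => y = 0) φ.1

/-- Finitely presented local subvarieties: germs of sets of common zeros of finitely many elements
of `𝓔(ℝ^d, 0)`. -/
def IsFinitelyPresented {d : ℕ} (X : SetGerm d) : Prop :=
  ∃ S : Finset (SmoothGerm d), X = S.inf zeroSet

/-- The preimage `g⁻¹(X)` of a germ of a set. -/
def preimage {d : ℕ} (g : DiffGerm d) (X : SetGerm d) : SetGerm d :=
  SelfMapGerm.compGerm X g.val

/-- The ideal of all germs of `C^∞` functions vanishing on a germ of a set. -/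
def vanishingIdeal {d : ℕ} (X : SetGerm d) : Ideal (SmoothGerm d) where
  carrier := {φ | X ≤ zeroSet φ}
  add_mem' := by
    rintro ⟨φ, hφ⟩ ⟨ψ, hψ⟩ h1 h2
    induction X using Germ.inductionOn with | _ X
    induction φ using Germ.inductionOn with | _ φ
    induction ψ using Germ.inductionOn with | _ ψ
    have h1' : ∀ᶠ x in 𝓝 (0 : E d), X x → φ x = 0 := h1
    have h2' : ∀ᶠ x in 𝓝 (0 : E d), X x → ψ x = 0 := h2
    have h3 : ∀ᶠ x in 𝓝 (0 : E d), X x → φ x + ψ x = 0 := by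
      filter_upwards [h1', h2'] with x a b hx
      rw [a hx, b hx, add_zero]
    exact h3
  zero_mem' := by
    induction X using Germ.inductionOn with | _ X
    have h3 : ∀ᶠ x in 𝓝 (0 : E d), X x → (0 : ℝ) = 0 := Eventually.of_forall fun _ _ => rfl
    exact h3
  smul_mem' := by
    rintro ⟨φ, hφ⟩ ⟨ψ, hψ⟩ h2
    induction X using Germ.inductionOn with | _ X
    induction φ using Germ.inductionOn with | _ φ
    induction ψ using Germ.inductionOn with | _ ψ
    have h2' : ∀ᶠ x in 𝓝 (0 : E d), X x → ψ x = 0 := h2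
    have h3 : ∀ᶠ x in 𝓝 (0 : E d), X x → φ x * ψ x = 0 := by
      filter_upwards [h2'] with x b hx
      rw [b hx, mul_zero]
    exact h3

end SmoothLocal

end

noncomputable section

namespace SmoothLocal

/-! ### Smoothness of integrals along rays -/

/-! The set of `g` in `G` with multiplicity at most `k` is, in suitable parameters, the locus where
some member of a family of functions in a fixed Noetherian ring is nonzero; such an increasing
sequence of sets must stabilise.

Parameters. For a germ `F` of a diffeomorphism, the Taylor coefficients of `F ^ n` of a given order
satisfy a linear recurrence in `n` whose matrix is the Jacobian of `F` and whose inhomogeneous term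
involves only lower orders. By induction on the order they all lie in the algebra generated by `n`
and the functions `l ^ n`, with `l` an eigenvalue of the Jacobian: the same finite set of generators
for every order (`goodMap_of_system`, `exists_goodMap_pow`). For a flow, the recurrence becomes a
linear differential equation and the generators become `t` and `exp (l * t)`
(`IsLocalFlow.exists_goodMap`). Since `G` is commutative, it is covered by products of finitely many
such families. Hence there are a parameter set `T` and a finitely generated, so Noetherian, algebra
`R` of functions on `T` containing all Taylor coefficients of the germs involved
(`parametrized_of_isFinitelyGenerated`).

Finite determinacy. By Nakayama's lemma, an ideal `K` has codimension at most `k` if and only if `K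
+ m ^ (k + 1)` does, `m` being the maximal ideal (`codim_sup_pow_le_iff`). This is a lower bound on
the rank of a family of vectors in a finite-dimensional jet space, so it says that some minor is
nonzero; the minors are elements of `R` (`exists_minors`).

Stabilisation. The functions of `R` vanishing wherever the multiplicity exceeds `k` form an
increasing chain of ideals. Once it is constant from `m` on, every finite multiplicity is at most
`m` (`exists_stable`). The ideals enter only through their finite-dimensional jets, so the argument
also covers vanishing ideals, which pull back correctly under diffeomorphisms
(`vanishingIdeal_preimage`). -/

theorem hasFDerivAt_integral_ray {V W : Type} [NormedAddCommGroup V] [NormedSpace ℝ V]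
    [ProperSpace V] [NormedAddCommGroup W] [NormedSpace ℝ W]
    (k : ℕ) {g : V → W} (hg : ContDiff ℝ 1 g) (x₀ : V) :
    HasFDerivAt (fun x => ∫ s in (0 : ℝ)..1, s ^ k • g (s • x))
      (∫ s in (0 : ℝ)..1, s ^ (k + 1) • fderiv ℝ g (s • x₀)) x₀ := by
  have hc : Continuous g := hg.continuous
  have hc' : Continuous (fderiv ℝ g) := hg.continuous_fderiv one_ne_zero
  have hcont : Continuous fun p : ℝ × V => p.1 ^ (k + 1) • fderiv ℝ g (p.1 • p.2) := by fun_prop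
  obtain ⟨C, hC⟩ := ((isCompact_Icc (a := (0 : ℝ)) (b := 1)).prod
    (isCompact_closedBall x₀ 1)).exists_bound_of_continuousOn hcont.continuousOn
  refine intervalIntegral.hasFDerivAt_integral_of_dominated_of_fderiv_le
    (F := fun x s => s ^ k • g (s • x)) (F' := fun x s => s ^ (k + 1) • fderiv ℝ g (s • x))
    (bound := fun _ => C) (Metric.closedBall_mem_nhds x₀ one_pos) ?_ ?_ ?_ ?_ ?_ ?_
  · exact Eventually.of_forall fun x => (Continuous.aestronglyMeasurable (by fun_prop))
  · exact Continuous.intervalIntegrable (by fun_prop) _ _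
  · exact Continuous.aestronglyMeasurable (by fun_prop)
  · refine Eventually.of_forall fun s hs x hx => ?_
    rw [Set.uIoc_of_le zero_le_one] at hs
    exact hC (s, x) ⟨⟨hs.1.le, hs.2⟩, hx⟩
  · exact intervalIntegrable_const
  · refine Eventually.of_forall fun s _ x _ => ?_
    have h1 : HasFDerivAt (fun x : V => s • x) (s • ContinuousLinearMap.id ℝ V) x :=
      (hasFDerivAt_id x).const_smul s
    have h2 := ((hg.differentiable one_ne_zero (s • x)).hasFDerivAt.comp x h1).const_smul (s ^ k)
    refine h2.congr_fderiv ?_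
    ext y
    simp [pow_succ, mul_smul]

/-- Differentiating replaces `g` by `fderiv ℝ g` and raises the power of `s` by one, so the
induction has to run over all `k` and all target spaces at once. It supplies the smooth coefficients
in Hadamard's lemma. -/
theorem contDiff_integral_ray {V : Type} [NormedAddCommGroup V] [NormedSpace ℝ V]
    [ProperSpace V] (n : ℕ) :
    ∀ {W : Type} [NormedAddCommGroup W] [NormedSpace ℝ W] (k : ℕ) {g : V → W},
      ContDiff ℝ ∞ g → ContDiff ℝ n (fun x => ∫ s in (0 : ℝ)..1, s ^ k • g (s • x)) := by
  induction n with
  | zero =>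
    intro W _ _ k g hg
    have hd : Differentiable ℝ (fun x => ∫ s in (0 : ℝ)..1, s ^ k • g (s • x)) :=
      fun x => (hasFDerivAt_integral_ray k (hg.of_le (by norm_cast)) x).differentiableAt
    exact contDiff_zero.2 hd.continuous
  | succ n ih =>
    intro W _ _ k g hg
    have hf := fun x => hasFDerivAt_integral_ray k (hg.of_le (by norm_cast)) x
    rw [Nat.cast_add, Nat.cast_one, contDiff_succ_iff_fderiv]
    refine ⟨fun x => (hf x).differentiableAt, by simp, ?_⟩
    rw [funext fun x => (hf x).fderiv]
    exact ih (k + 1) (hg.fderiv_right (m := ∞) (by simp))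

/-! ### Global representatives of germs -/

/-- Cutting off by a bump function makes a representative globally smooth, so identities between
germs can be checked on global functions. -/
theorem exists_contDiff_eventuallyEq {d : ℕ} {W : Type*} [NormedAddCommGroup W] [NormedSpace ℝ W]
    {f : E d → W} (hf : ∀ᶠ x in 𝓝 (0 : E d), ContDiffAt ℝ ∞ f x) :
    ∃ h : E d → W, ContDiff ℝ ∞ h ∧ h =ᶠ[𝓝 0] f := by
  obtain ⟨r, hr, hf⟩ := Metric.eventually_nhds_iff_ball.1 hf
  let b : ContDiffBump (0 : E d) := ⟨r / 4, r / 2, by positivity, by linarith⟩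
  refine ⟨fun x => b x • f x, ?_, ?_⟩
  · refine contDiff_iff_contDiffAt.2 fun x => ?_
    by_cases hx : x ∈ tsupport b
    swap
    · refine (contDiffAt_const (c := (0 : W))).congr_of_eventuallyEq ?_
      filter_upwards [notMem_tsupport_iff_eventuallyEq.1 hx] with y hy
      simp [hy]
    rw [b.tsupport_eq] at hx
    have hx2 : x ∈ Metric.ball (0 : E d) r :=
      Metric.closedBall_subset_ball (by change r / 2 < r; linarith) hx
    exact b.contDiffAt.smul (hf x hx2)
  · filter_upwards [b.eventuallyEq_one] with x hx
    simp [hx]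

/-- The germ at the origin of a smooth function. -/
def toGerm {d : ℕ} (f : E d → ℝ) (hf : ContDiff ℝ ∞ f) : SmoothGerm d :=
  ⟨(f : Germ (𝓝 (0 : E d)) ℝ), f, Eventually.of_forall fun _ => hf.contDiffAt, rfl⟩

theorem exists_eq_toGerm {d : ℕ} (φ : SmoothGerm d) : ∃ f hf, φ = toGerm f hf := by
  obtain ⟨_, f, hf, rfl⟩ := φ
  obtain ⟨h, hh, he⟩ := exists_contDiff_eventuallyEq hf
  exact ⟨h, hh, Subtype.ext (Germ.coe_eq.2 he.symm)⟩

theorem toGerm_eq {d : ℕ} {f h : E d → ℝ} {hf : ContDiff ℝ ∞ f} {hh : ContDiff ℝ ∞ h} :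
    toGerm f hf = toGerm h hh ↔ f =ᶠ[𝓝 0] h :=
  Subtype.ext_iff.trans Germ.coe_eq

/-- The germ of a smooth self-map of `ℝ^d` fixing the origin. -/
def toMapGerm {d : ℕ} (f : E d → E d) (hf : ContDiff ℝ ∞ f) (h0 : f 0 = 0) : SelfMapGerm d :=
  ⟨(f : Germ (𝓝 (0 : E d)) (E d)), f, Eventually.of_forall fun _ => hf.contDiffAt, h0, rfl⟩

theorem exists_eq_toMapGerm {d : ℕ} (F : SelfMapGerm d) : ∃ f hf h0, F = toMapGerm f hf h0 := by
  obtain ⟨_, f, hf, h0, rfl⟩ := F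
  obtain ⟨h, hh, he⟩ := exists_contDiff_eventuallyEq hf
  exact ⟨h, hh, he.self_of_nhds.trans h0, Subtype.ext (Germ.coe_eq.2 he.symm)⟩

theorem pullback_toGerm {d : ℕ} (f : E d → E d) (hf : ContDiff ℝ ∞ f) (h0 : f 0 = 0)
    (h : E d → ℝ) (hh : ContDiff ℝ ∞ h) :
    pullback (toMapGerm f hf h0) (toGerm h hh) = toGerm (h ∘ f) (hh.comp hf) := rfl

theorem toGerm_add {d : ℕ} {f h : E d → ℝ} (hf : ContDiff ℝ ∞ f) (hh : ContDiff ℝ ∞ h) :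
    toGerm f hf + toGerm h hh = toGerm (fun x => f x + h x) (hf.add hh) := rfl

theorem toGerm_mul {d : ℕ} {f h : E d → ℝ} (hf : ContDiff ℝ ∞ f) (hh : ContDiff ℝ ∞ h) :
    toGerm f hf * toGerm h hh = toGerm (fun x => f x * h x) (hf.mul hh) := rfl

theorem algebraMap_eq {d : ℕ} (c : ℝ) :
    algebraMap ℝ (SmoothGerm d) c = toGerm (fun _ => c) contDiff_const := rfl

theorem pullback_mul {d : ℕ} (F H : SelfMapGerm d) (φ : SmoothGerm d) :
    pullback (F * H) φ = pullback H (pullback F φ) := by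
  obtain ⟨f, hf, f0, rfl⟩ := exists_eq_toMapGerm F
  obtain ⟨h, hh, h0, rfl⟩ := exists_eq_toMapGerm H
  obtain ⟨u, hu, rfl⟩ := exists_eq_toGerm φ
  rfl

theorem pullback_one {d : ℕ} (φ : SmoothGerm d) : pullback (1 : SelfMapGerm d) φ = φ := by
  obtain ⟨u, hu, rfl⟩ := exists_eq_toGerm φ
  rfl

theorem pullback_algebraMap {d : ℕ} (F : SelfMapGerm d) (c : ℝ) :
    pullback F (algebraMap ℝ (SmoothGerm d) c) = algebraMap ℝ (SmoothGerm d) c := by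
  obtain ⟨f, hf, f0, rfl⟩ := exists_eq_toMapGerm F
  rfl

theorem pullback_smul {d : ℕ} (F : SelfMapGerm d) (c : ℝ) (φ : SmoothGerm d) :
    pullback F (c • φ) = c • pullback F φ := by
  rw [Algebra.smul_def, map_mul, pullback_algebraMap, ← Algebra.smul_def]

/-! ### Values, coordinates and partial derivatives of germs -/

/-- The value of a germ at the origin. -/
def ev (d : ℕ) : SmoothGerm d →ₐ[ℝ] ℝ where
  toRingHom := Germ.valueRingHom.comp (smoothGermSubring d).subtype
  commutes' _ := rfl

theorem ev_toGerm {d : ℕ} (f : E d → ℝ) (hf : ContDiff ℝ ∞ f) : ev d (toGerm f hf) = f 0 := rfl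

theorem ev_pullback {d : ℕ} (F : SelfMapGerm d) (φ : SmoothGerm d) :
    ev d (pullback F φ) = ev d φ := by
  obtain ⟨f, hf, f0, rfl⟩ := exists_eq_toMapGerm F
  obtain ⟨u, hu, rfl⟩ := exists_eq_toGerm φ
  simp [pullback_toGerm, ev_toGerm, f0]

/-- The germ of the `i`-th coordinate function. -/
def coord {d : ℕ} (i : Fin d) : SmoothGerm d := toGerm (fun x => x i) (contDiff_apply ℝ ℝ i)

theorem ev_coord {d : ℕ} (i : Fin d) : ev d (coord i) = 0 := rfl

theorem contDiff_fderiv_apply {V W : Type*} [NormedAddCommGroup V] [NormedSpace ℝ V]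
    [NormedAddCommGroup W] [NormedSpace ℝ W] {f : V → W} (hf : ContDiff ℝ ∞ f) (v : V) :
    ContDiff ℝ ∞ (fun x => fderiv ℝ f x v) :=
  (hf.fderiv_right (m := ∞) (by simp)).clm_apply contDiff_const

/-- The partial derivative of a germ, as a function. -/
def pderivFun {d : ℕ} (i : Fin d) (φ : SmoothGerm d) : SmoothGerm d :=
  toGerm (fun x => fderiv ℝ (exists_eq_toGerm φ).choose x (Pi.single i (1 : ℝ)))
    (contDiff_fderiv_apply (exists_eq_toGerm φ).choose_spec.choose _)

theorem pderivFun_toGerm {d : ℕ} (i : Fin d) (f : E d → ℝ) (hf : ContDiff ℝ ∞ f) :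
    pderivFun i (toGerm f hf) =
      toGerm (fun x => fderiv ℝ f x (Pi.single i 1)) (contDiff_fderiv_apply hf _) := by
  have h := (exists_eq_toGerm (toGerm f hf)).choose_spec.choose_spec
  rw [toGerm_eq] at h
  rw [pderivFun, toGerm_eq]
  filter_upwards [h.fderiv (𝕜 := ℝ)] with x hx
  rw [hx]

/-- The partial derivative of a germ, as a linear map. -/
def pderiv {d : ℕ} (i : Fin d) : SmoothGerm d →ₗ[ℝ] SmoothGerm d where
  toFun := pderivFun i
  map_add' φ ψ := by
    obtain ⟨f, hf, rfl⟩ := exists_eq_toGerm φ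
    obtain ⟨h, hh, rfl⟩ := exists_eq_toGerm ψ
    rw [toGerm_add, pderivFun_toGerm, pderivFun_toGerm, pderivFun_toGerm, toGerm_add, toGerm_eq]
    refine Eventually.of_forall fun x => ?_
    simp only
    rw [fderiv_fun_add (hf.differentiable (by simp) x) (hh.differentiable (by simp) x)]
    rfl
  map_smul' c φ := by
    obtain ⟨f, hf, rfl⟩ := exists_eq_toGerm φ
    rw [Algebra.smul_def, algebraMap_eq, toGerm_mul, pderivFun_toGerm, pderivFun_toGerm,
      RingHom.id_apply, Algebra.smul_def, algebraMap_eq, toGerm_mul, toGerm_eq]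
    refine Eventually.of_forall fun x => ?_
    simp only
    rw [fderiv_const_mul (hf.differentiable (by simp) x)]
    rfl

theorem pderiv_toGerm {d : ℕ} (i : Fin d) (f : E d → ℝ) (hf : ContDiff ℝ ∞ f) :
    pderiv i (toGerm f hf) =
      toGerm (fun x => fderiv ℝ f x (Pi.single i 1)) (contDiff_fderiv_apply hf _) :=
  pderivFun_toGerm i f hf

theorem pderiv_mul {d : ℕ} (i : Fin d) (φ ψ : SmoothGerm d) :
    pderiv i (φ * ψ) = pderiv i φ * ψ + φ * pderiv i ψ := by
  obtain ⟨f, hf, rfl⟩ := exists_eq_toGerm φ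
  obtain ⟨h, hh, rfl⟩ := exists_eq_toGerm ψ
  rw [toGerm_mul, pderiv_toGerm, pderiv_toGerm, pderiv_toGerm, toGerm_mul, toGerm_mul, toGerm_add,
    toGerm_eq]
  refine Eventually.of_forall fun x => ?_
  simp only
  rw [fderiv_fun_mul (hf.differentiable (by simp) x) (hh.differentiable (by simp) x)]
  simp
  ring

theorem pderiv_coord {d : ℕ} (i j : Fin d) :
    pderiv i (coord j : SmoothGerm d) = if i = j then 1 else 0 := by
  rw [coord, pderiv_toGerm]
  trans toGerm (fun _ => if i = j then 1 else 0) contDiff_const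
  · refine toGerm_eq.2 (Eventually.of_forall fun x => ?_)
    have : HasFDerivAt (fun x : E d => x j) (ContinuousLinearMap.proj j : E d →L[ℝ] ℝ) x :=
      (ContinuousLinearMap.proj j : E d →L[ℝ] ℝ).hasFDerivAt
    simp only
    rw [this.fderiv]
    simp [Pi.single_apply, eq_comm]
  · split_ifs <;> rfl

theorem toGerm_sum {d : ℕ} {ι : Type*} (s : Finset ι) (f : ι → E d → ℝ)
    (hf : ∀ i, ContDiff ℝ ∞ (f i)) :
    ∑ i ∈ s, toGerm (f i) (hf i) = toGerm (fun x => ∑ i ∈ s, f i x)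
      (ContDiff.sum fun i _ => hf i) := by
  classical
  induction s using Finset.induction_on with
  | empty => rfl
  | insert a s ha ih =>
    rw [Finset.sum_insert ha, ih, toGerm_add, toGerm_eq]
    exact Eventually.of_forall fun x => by simp [Finset.sum_insert ha]

theorem fderiv_eq_sum_coord {d : ℕ} {W : Type*} [NormedAddCommGroup W] [NormedSpace ℝ W]
    (L : E d →L[ℝ] W) (y : E d) : L y = ∑ j, y j • L (Pi.single j 1) := by
  conv_lhs => rw [← Finset.univ_sum_single y, map_sum]
  refine Finset.sum_congr rfl fun j _ => ?_
  rw [← map_smul, ← Pi.single_smul, smul_eq_mul, mul_one]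

/-- The chain rule. -/
theorem pderiv_pullback {d : ℕ} (i : Fin d) (F : SelfMapGerm d) (φ : SmoothGerm d) :
    pderiv i (pullback F φ) =
      ∑ j, pderiv i (pullback F (coord j)) * pullback F (pderiv j φ) := by
  obtain ⟨f, hf, f0, rfl⟩ := exists_eq_toMapGerm F
  obtain ⟨u, hu, rfl⟩ := exists_eq_toGerm φ
  simp only [coord, pullback_toGerm, pderiv_toGerm, toGerm_mul]
  rw [toGerm_sum _ (fun j x => _) (fun j => _), toGerm_eq]
  refine Eventually.of_forall fun x => ?_
  have hfx := (hf.differentiable (by simp) x)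
  simp only
  rw [fderiv_comp x (hu.differentiable (by simp) _) hfx, ContinuousLinearMap.comp_apply,
    fderiv_eq_sum_coord]
  refine Finset.sum_congr rfl fun j _ => ?_
  rw [smul_eq_mul]
  congr 1
  have h2 := ((ContinuousLinearMap.proj j : E d →L[ℝ] ℝ).hasFDerivAt.comp x hfx.hasFDerivAt)
  have h3 : fderiv ℝ ((fun x : E d => x j) ∘ f) x = _ := h2.fderiv
  rw [h3]
  rfl

/-! ### The maximal ideal -/

/-- The ideal of germs vanishing at the origin. -/
def maxIdeal (d : ℕ) : Ideal (SmoothGerm d) := RingHom.ker (ev d)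

theorem mem_maxIdeal {d : ℕ} {φ : SmoothGerm d} : φ ∈ maxIdeal d ↔ ev d φ = 0 := Iff.rfl

/-- Hadamard's lemma. -/
theorem exists_eq_sum_coord_mul {d : ℕ} {φ : SmoothGerm d} (hφ : φ ∈ maxIdeal d) :
    ∃ h : Fin d → SmoothGerm d, φ = ∑ i, coord i * h i := by
  obtain ⟨f, hf, rfl⟩ := exists_eq_toGerm φ
  have f0 : f 0 = 0 := hφ
  have hs : ∀ i, ContDiff ℝ ∞ fun x : E d =>
      ∫ s in (0 : ℝ)..1, s ^ 0 • (fderiv ℝ f (s • x) (Pi.single i 1)) := fun i =>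
    contDiff_infty.2 fun n => contDiff_integral_ray n 0
      (g := fun x => fderiv ℝ f x (Pi.single i 1)) (contDiff_fderiv_apply hf _)
  refine ⟨fun i => toGerm _ (hs i), ?_⟩
  simp only [coord, toGerm_mul]
  rw [toGerm_sum _ (fun j x => _) (fun j => _), toGerm_eq]
  refine Eventually.of_forall fun x => ?_
  have hd : ∀ s : ℝ, HasDerivAt (fun s : ℝ => f (s • x)) (fderiv ℝ f (s • x) x) s := by
    intro s
    have h1 : HasDerivAt (fun s : ℝ => s • x) x s := by
      simpa using (hasDerivAt_id s).smul_const x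
    exact (hf.differentiable (by simp) (s • x)).hasFDerivAt.comp_hasDerivAt s h1
  have hcf : Continuous (fderiv ℝ f) := hf.continuous_fderiv (by simp)
  have hI := intervalIntegral.integral_eq_sub_of_hasDerivAt (a := 0) (b := 1)
    (fun s _ => hd s) (Continuous.intervalIntegrable (by fun_prop) _ _)
  simp only [one_smul, zero_smul, f0, sub_zero] at hI
  rw [← hI]
  simp only [pow_zero, one_smul]
  rw [intervalIntegral.integral_congr (g := fun s => ∑ j, x j * fderiv ℝ f (s • x) (Pi.single j 1))
    (fun s _ => by simp only; rw [fderiv_eq_sum_coord]; rfl)]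
  rw [intervalIntegral.integral_finsetSum
    (fun i _ => Continuous.intervalIntegrable (by fun_prop) _ _)]
  simp only [intervalIntegral.integral_const_mul]

theorem maxIdeal_eq_span (d : ℕ) : maxIdeal d = Ideal.span (Set.range coord) := by
  apply le_antisymm
  · intro φ hφ
    obtain ⟨h, rfl⟩ := exists_eq_sum_coord_mul hφ
    exact Ideal.sum_mem _ fun i _ => Ideal.mul_mem_right _ _ (Ideal.subset_span ⟨i, rfl⟩)
  · rw [Ideal.span_le]
    rintro _ ⟨i, rfl⟩
    exact ev_coord i

theorem isUnit_of_ev_ne_zero {d : ℕ} {φ : SmoothGerm d} (h : ev d φ ≠ 0) : IsUnit φ := by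
  obtain ⟨f, hf, rfl⟩ := exists_eq_toGerm φ
  have hne : ∀ᶠ x in 𝓝 (0 : E d), f x ≠ 0 := hf.continuous.continuousAt.eventually_ne h
  have hi : ∀ᶠ x in 𝓝 (0 : E d), ContDiffAt ℝ ∞ (fun x => (f x)⁻¹) x := by
    filter_upwards [hne] with x hx using hf.contDiffAt.inv hx
  obtain ⟨u, hu, he⟩ := exists_contDiff_eventuallyEq hi
  refine IsUnit.of_mul_eq_one (toGerm u hu) ?_
  rw [toGerm_mul]
  refine (toGerm_eq (hh := contDiff_const)).2 (?_ : _ =ᶠ[_] fun _ => (1 : ℝ))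
  filter_upwards [hne, he] with x hx hx'
  rw [hx', mul_inv_cancel₀ hx]

/-- Germs with nonzero value are units; this is the form of locality that Nakayama's lemma uses. -/
theorem maxIdeal_le_jacobson (d : ℕ) : maxIdeal d ≤ Ideal.jacobson ⊥ := by
  intro φ hφ
  rw [Ideal.mem_jacobson_bot]
  intro ψ
  apply isUnit_of_ev_ne_zero
  rw [map_add, map_mul, mem_maxIdeal.1 hφ]
  simp

/-! ### Jets and powers of the maximal ideal -/

/-- Iterated partial derivatives, indexed by words. -/
def iterPderiv {d : ℕ} : List (Fin d) → SmoothGerm d →ₗ[ℝ] SmoothGerm d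
  | [] => LinearMap.id
  | i :: w => iterPderiv w ∘ₗ pderiv i

/-- The value at the origin of an iterated partial derivative. -/
def jet {d : ℕ} (w : List (Fin d)) : SmoothGerm d →ₗ[ℝ] ℝ := (ev d).toLinearMap ∘ₗ iterPderiv w

@[simp] theorem jet_nil {d : ℕ} (φ : SmoothGerm d) : jet [] φ = ev d φ := rfl

@[simp] theorem jet_cons {d : ℕ} (i : Fin d) (w : List (Fin d)) (φ : SmoothGerm d) :
    jet (i :: w) φ = jet w (pderiv i φ) := rfl

theorem pderiv_mem_pow {d : ℕ} (i : Fin d) (k : ℕ) :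
    ∀ {φ : SmoothGerm d}, φ ∈ maxIdeal d ^ (k + 1) → pderiv i φ ∈ maxIdeal d ^ k := by
  induction k with
  | zero => intro φ _; simp
  | succ k ih =>
    intro φ hφ
    rw [pow_succ'] at hφ
    refine Submodule.mul_induction_on hφ (fun a ha b hb => ?_) (fun a b ha hb => ?_)
    · rw [pderiv_mul]
      refine add_mem (Ideal.mul_mem_left _ _ hb) ?_
      rw [pow_succ']
      exact Ideal.mul_mem_mul ha (ih hb)
    · rw [map_add]; exact add_mem ha hb

/-- The Euler vector field. -/
def euler {d : ℕ} : SmoothGerm d →ₗ[ℝ] SmoothGerm d :=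
  ∑ i, LinearMap.mulLeft ℝ (coord i) ∘ₗ pderiv i

theorem euler_apply {d : ℕ} (φ : SmoothGerm d) : euler φ = ∑ i, coord i * pderiv i φ := by
  simp [euler]

theorem euler_mul {d : ℕ} (φ ψ : SmoothGerm d) : euler (φ * ψ) = euler φ * ψ + φ * euler ψ := by
  simp only [euler_apply, pderiv_mul, Finset.sum_mul, Finset.mul_sum, ← Finset.sum_add_distrib]
  exact Finset.sum_congr rfl fun i _ => by ring

theorem coord_mem {d : ℕ} (i : Fin d) : coord i ∈ maxIdeal d := ev_coord i

theorem euler_mem {d : ℕ} (φ : SmoothGerm d) : euler φ ∈ maxIdeal d := by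
  rw [euler_apply]
  exact Ideal.sum_mem _ fun i _ => Ideal.mul_mem_right _ _ (coord_mem i)

theorem euler_coord {d : ℕ} (j : Fin d) : euler (coord j) = coord j := by
  simp [euler_apply, pderiv_coord]

/-- The Euler field acts on `m ^ k / m ^ (k + 1)` as multiplication by `k`. -/
theorem euler_sub_mem {d : ℕ} (k : ℕ) :
    ∀ {φ : SmoothGerm d}, φ ∈ maxIdeal d ^ k → euler φ - (k : ℝ) • φ ∈ maxIdeal d ^ (k + 1) := by
  induction k with
  | zero => intro φ _; simpa using euler_mem φ
  | succ k ih =>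
    intro φ hφ
    rw [pow_succ'] at hφ
    refine Submodule.mul_induction_on hφ (fun a ha b hb => ?_) (fun a b ha hb => ?_)
    · have h1 : euler a - a ∈ maxIdeal d * maxIdeal d := by
        obtain ⟨h, rfl⟩ := exists_eq_sum_coord_mul ha
        rw [map_sum, ← Finset.sum_sub_distrib]
        refine Ideal.sum_mem _ fun i _ => ?_
        rw [euler_mul, euler_coord, add_sub_cancel_left]
        exact Ideal.mul_mem_mul (coord_mem i) (euler_mem _)
      have h2 : euler (a * b) - ((k + 1 : ℕ) : ℝ) • (a * b) =
          (euler a - a) * b + a * (euler b - (k : ℝ) • b) := by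
        rw [euler_mul, Nat.cast_add, Nat.cast_one, add_smul, one_smul, mul_sub, mul_smul_comm]
        ring
      rw [h2]
      refine add_mem ?_ ?_
      · have := Ideal.mul_mem_mul h1 hb
        rwa [mul_assoc, ← pow_succ', ← pow_succ'] at this
      · have := Ideal.mul_mem_mul ha (ih hb)
        rwa [← pow_succ'] at this
    · have : euler (a + b) - ((k + 1 : ℕ) : ℝ) • (a + b) =
          (euler a - ((k + 1 : ℕ) : ℝ) • a) + (euler b - ((k + 1 : ℕ) : ℝ) • b) := by
        rw [map_add, smul_add]; ring
      rw [this]; exact add_mem ha hb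

/-- A substitute for Taylor's formula with remainder: if the jets of order at most `k` vanish, the
first derivatives lie in `m ^ k` by induction, so `euler φ` lies in `m ^ (k + 1)`; but `euler φ` is
`k • φ` modulo `m ^ (k + 1)`. -/
theorem mem_pow_iff {d : ℕ} (k : ℕ) : ∀ {φ : SmoothGerm d},
    φ ∈ maxIdeal d ^ k ↔ ∀ w : List (Fin d), w.length < k → jet w φ = 0 := by
  induction k with
  | zero => simp
  | succ k ih =>
    intro φ
    constructor
    · rintro hφ (_ | ⟨i, w⟩) hw
      · exact Ideal.pow_le_self (Nat.succ_ne_zero k) hφ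
      · exact ih.1 (pderiv_mem_pow i k hφ) w (by simpa using hw)
    · intro h
      rcases Nat.eq_zero_or_pos k with rfl | hk
      · rw [zero_add, pow_one]; exact h [] (by simp)
      have h1 : φ ∈ maxIdeal d ^ k := ih.2 fun w hw => h w (by omega)
      have h2 : euler φ ∈ maxIdeal d ^ (k + 1) := by
        rw [euler_apply, pow_succ']
        refine Ideal.sum_mem _ fun i _ => Ideal.mul_mem_mul (coord_mem i) ?_
        exact ih.2 fun w hw => h (i :: w) (by simpa using hw)
      have h3 := sub_mem h2 (euler_sub_mem k h1)
      rw [sub_sub_cancel] at h3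
      have hk' : (k : ℝ) ≠ 0 := by positivity
      have h4 : φ = algebraMap ℝ (SmoothGerm d) (k : ℝ)⁻¹ * ((k : ℝ) • φ) := by
        rw [← Algebra.smul_def, inv_smul_smul₀ hk']
      rw [h4]
      exact Ideal.mul_mem_left _ _ h3

instance finite_words (d N : ℕ) : Finite {w : List (Fin d) // w.length < N} :=
  List.finite_length_lt (Fin d) N

/-- The jet of order `< N` of a germ, given by the values of its partial derivatives. -/
def jets (d N : ℕ) : SmoothGerm d →ₗ[ℝ] ({w : List (Fin d) // w.length < N} → ℝ) :=
  LinearMap.pi fun w => jet w.1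

theorem jets_eq_zero {d N : ℕ} {φ : SmoothGerm d} : jets d N φ = 0 ↔ φ ∈ maxIdeal d ^ N := by
  rw [mem_pow_iff, funext_iff, Subtype.forall]
  rfl

/-! ### Codimension of ideals -/

/-- Nakayama's lemma, applicable because `m ^ k` is finitely generated by Hadamard's lemma. -/
theorem le_of_pow_le_sup {d k : ℕ} {L : Ideal (SmoothGerm d)}
    (h : maxIdeal d ^ k ≤ L ⊔ maxIdeal d ^ (k + 1)) : maxIdeal d ^ k ≤ L := by
  refine Submodule.le_of_le_smul_of_le_jacobson_bot (I := maxIdeal d) ?_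
    (maxIdeal_le_jacobson d) ?_
  · rw [maxIdeal_eq_span]
    exact Submodule.FG.pow (Submodule.fg_span (Set.finite_range coord)) k
  · rwa [smul_eq_mul, ← pow_succ']

/-- The quotient of the germs by an ideal surjects onto the quotient by a larger ideal. -/
def quotFactor {d : ℕ} {K L : Ideal (SmoothGerm d)} (h : K ≤ L) :
    (SmoothGerm d ⧸ K) →ₗ[ℝ] (SmoothGerm d ⧸ L) := (Ideal.Quotient.factorₐ ℝ h).toLinearMap

theorem quotFactor_surjective {d : ℕ} {K L : Ideal (SmoothGerm d)} (h : K ≤ L) :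
    Function.Surjective (quotFactor h) := Ideal.Quotient.factor_surjective h

theorem finrank_quot_add {d : ℕ} {K L : Ideal (SmoothGerm d)} (h : K ≤ L)
    [Module.Finite ℝ (SmoothGerm d ⧸ K)] :
    Module.finrank ℝ (SmoothGerm d ⧸ L) +
      Module.finrank ℝ (LinearMap.ker (quotFactor h)) = Module.finrank ℝ (SmoothGerm d ⧸ K) := by
  rw [← LinearMap.finrank_range_add_finrank_ker (quotFactor h),
    LinearMap.range_eq_top.2 (quotFactor_surjective h), finrank_top]

theorem finrank_quot_lt {d : ℕ} {K L : Ideal (SmoothGerm d)} (h : K < L)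
    [Module.Finite ℝ (SmoothGerm d ⧸ K)] :
    Module.finrank ℝ (SmoothGerm d ⧸ L) < Module.finrank ℝ (SmoothGerm d ⧸ K) := by
  rw [← finrank_quot_add h.le]
  refine Nat.lt_add_of_pos_right (Nat.pos_of_ne_zero fun h0 => ?_)
  obtain ⟨x, hxL, hxK⟩ := SetLike.exists_of_lt h
  have hb := Submodule.finrank_eq_zero.1 h0
  have hx : Ideal.Quotient.mk K x ∈ LinearMap.ker (quotFactor h.le) :=
    Ideal.Quotient.eq_zero_iff_mem.2 hxL
  rw [hb, Submodule.mem_bot] at hx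
  exact hxK (Ideal.Quotient.eq_zero_iff_mem.1 hx)

theorem pow_le_of_finrank_le {d k : ℕ} {L : Ideal (SmoothGerm d)}
    [Module.Finite ℝ (SmoothGerm d ⧸ L)] (h : Module.finrank ℝ (SmoothGerm d ⧸ L) ≤ k) :
    maxIdeal d ^ k ≤ L := by
  by_contra hk
  have hfin : ∀ j, Module.Finite ℝ (SmoothGerm d ⧸ (L ⊔ maxIdeal d ^ j)) := fun j =>
    Module.Finite.of_surjective _ (quotFactor_surjective (le_sup_left : L ≤ L ⊔ maxIdeal d ^ j))
  have hj : ∀ j ≤ k, j ≤ Module.finrank ℝ (SmoothGerm d ⧸ (L ⊔ maxIdeal d ^ j)) := by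
    intro j
    induction j with
    | zero => simp
    | succ j ih =>
      intro hjk
      have h1 := ih (by omega)
      have := hfin (j + 1)
      -- If the chain `L + m ^ j` paused at some `j < k`, Nakayama would give `m ^ j ≤ L`, hence `m
      -- ^ k ≤ L`. So each step up to `k` costs a dimension, and the strict inclusion of `L` in `L +
      -- m ^ k` costs one more.
      refine Nat.succ_le_of_lt (h1.trans_lt (finrank_quot_lt (lt_of_le_of_ne
        (sup_le_sup_left (Ideal.pow_le_pow_right (Nat.le_succ j)) L) fun he => hk ?_)))
      exact (Ideal.pow_le_pow_right (by omega)).trans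
        (le_of_pow_le_sup (he ▸ le_sup_right : maxIdeal d ^ j ≤ _))
  have h2 := finrank_quot_lt (left_lt_sup.2 hk)
  have := hj k le_rfl
  omega

theorem codim_le_iff {d k : ℕ} {K : Ideal (SmoothGerm d)} :
    codim K ≤ (k : ℕ∞) ↔
      Module.Finite ℝ (SmoothGerm d ⧸ K) ∧ Module.finrank ℝ (SmoothGerm d ⧸ K) ≤ k := by
  rw [codim, Cardinal.toENat_le_natCast]
  constructor
  · intro h
    have hfree : Module.Free ℝ (SmoothGerm d ⧸ K) := Module.Free.of_divisionRing ℝ _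
    have hf : Module.Finite ℝ (SmoothGerm d ⧸ K) :=
      Module.rank_lt_aleph0_iff.1 (h.trans_lt Cardinal.natCast_lt_aleph0)
    exact ⟨hf, Module.finrank_le_of_rank_le h⟩
  · rintro ⟨hf, h⟩
    rw [← Module.finrank_eq_rank]
    exact_mod_cast h

theorem pow_le_of_codim_le {d k : ℕ} {K : Ideal (SmoothGerm d)} (h : codim K ≤ (k : ℕ∞)) :
    maxIdeal d ^ k ≤ K := by
  obtain ⟨hf, h⟩ := codim_le_iff.1 h
  exact pow_le_of_finrank_le h

theorem codim_anti {d : ℕ} {K L : Ideal (SmoothGerm d)} (h : K ≤ L) : codim L ≤ codim K :=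
  Cardinal.toENat.monotone' (LinearMap.rank_le_of_surjective _ (quotFactor_surjective h))

/-- Codimension at most `k` on the left gives `m ^ k ≤ K + m ^ (k + 1)`, so `m ^ k ≤ K` by Nakayama
and the added power changes nothing. Thus the condition is read off jets of order at most `k`. -/
theorem codim_sup_pow_le_iff {d k : ℕ} {K : Ideal (SmoothGerm d)} :
    codim (K ⊔ maxIdeal d ^ (k + 1)) ≤ (k : ℕ∞) ↔ codim K ≤ (k : ℕ∞) := by
  refine ⟨fun h => ?_, (codim_anti le_sup_left).trans⟩
  have h1 := le_of_pow_le_sup (pow_le_of_codim_le h)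
  rwa [sup_eq_left.2 ((Ideal.pow_le_pow_right (Nat.le_succ k)).trans h1)] at h

theorem ker_jets_restrict {d N : ℕ} :
    (LinearMap.ker (jets d N)) = (maxIdeal d ^ N).restrictScalars ℝ := by
  ext φ
  exact jets_eq_zero

/-- The jet map on the quotient by a power of the maximal ideal. -/
def quotJets (d N : ℕ) :
    (SmoothGerm d ⧸ maxIdeal d ^ N) →ₗ[ℝ] ({w : List (Fin d) // w.length < N} → ℝ) :=
  Submodule.liftQ ((maxIdeal d ^ N).restrictScalars ℝ) (jets d N) ker_jets_restrict.ge

theorem quotJets_mk {d N : ℕ} (φ : SmoothGerm d) :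
    quotJets d N (Ideal.Quotient.mk _ φ) = jets d N φ := rfl

theorem quotJets_injective (d N : ℕ) : Function.Injective (quotJets d N) := by
  rw [injective_iff_map_eq_zero]
  intro x hx
  obtain ⟨φ, rfl⟩ := Ideal.Quotient.mk_surjective x
  exact Ideal.Quotient.eq_zero_iff_mem.2 (jets_eq_zero.1 hx)

instance finite_quot_pow (d N : ℕ) : Module.Finite ℝ (SmoothGerm d ⧸ maxIdeal d ^ N) :=
  Module.Finite.of_injective _ (quotJets_injective d N)

/-- The truncated subtraction is harmless: when `k` exceeds the dimension of the jet space, both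
sides hold. -/
theorem codim_sup_pow_le_iff_finrank {d N k : ℕ} {K : Ideal (SmoothGerm d)} :
    codim (K ⊔ maxIdeal d ^ N) ≤ (k : ℕ∞) ↔
      Module.finrank ℝ (SmoothGerm d ⧸ maxIdeal d ^ N) - k ≤
        Module.finrank ℝ ((K.restrictScalars ℝ).map (jets d N)) := by
  have hle : maxIdeal d ^ N ≤ K ⊔ maxIdeal d ^ N := le_sup_right
  have hfin : Module.Finite ℝ (SmoothGerm d ⧸ (K ⊔ maxIdeal d ^ N)) :=
    Module.Finite.of_surjective _ (quotFactor_surjective hle)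
  have h1 := finrank_quot_add hle
  have h2 : (LinearMap.ker (quotFactor hle)).map (quotJets d N) =
      (K.restrictScalars ℝ).map (jets d N) := by
    ext y
    simp only [Submodule.mem_map]
    constructor
    · rintro ⟨x, hx, rfl⟩
      obtain ⟨φ, rfl⟩ := Ideal.Quotient.mk_surjective x
      have hφ : φ ∈ K ⊔ maxIdeal d ^ N := Ideal.Quotient.eq_zero_iff_mem.1 hx
      obtain ⟨a, ha, b, hb, rfl⟩ := Submodule.mem_sup.1 hφ
      refine ⟨a, ha, ?_⟩
      rw [quotJets_mk, map_add, jets_eq_zero.2 hb, add_zero]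
    · rintro ⟨a, ha, rfl⟩
      exact ⟨Ideal.Quotient.mk _ a,
        Ideal.Quotient.eq_zero_iff_mem.2 (Ideal.mem_sup_left ha), rfl⟩
  rw [codim_le_iff, ← h2,
    ← (Submodule.equivMapOfInjective _ (quotJets_injective d N) _).finrank_eq]
  constructor
  · rintro ⟨-, h⟩; omega
  · intro h; exact ⟨hfin, by omega⟩

/-! ### Families of germs with jets in an algebra of functions -/

/-- A family of germs indexed by `T` whose jets of order `< k` are functions on `T` that belong
to the algebra `R`. -/
def Good {d : ℕ} {T : Type*} (R : Subalgebra ℂ (T → ℂ)) (k : ℕ) (Φ : T → SmoothGerm d) : Prop :=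
  ∀ w : List (Fin d), w.length < k → (fun t => (jet w (Φ t) : ℂ)) ∈ R

section Good

variable {d : ℕ} {T : Type*} {R : Subalgebra ℂ (T → ℂ)} {k : ℕ} {Φ Ψ : T → SmoothGerm d}

theorem good_zero : Good R 0 Φ := fun w hw => absurd hw (by simp)

theorem good_succ : Good R (k + 1) Φ ↔
    (fun t => (ev d (Φ t) : ℂ)) ∈ R ∧ ∀ i, Good R k fun t => pderiv i (Φ t) := by
  constructor
  · intro h
    exact ⟨h [] (by simp), fun i w hw => h (i :: w) (by simpa using hw)⟩
  · rintro ⟨h1, h2⟩ (_ | ⟨i, w⟩) hw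
    · exact h1
    · exact h2 i w (by simpa using hw)

theorem Good.mono {l : ℕ} (h : Good R k Φ) (hl : l ≤ k) : Good R l Φ :=
  fun w hw => h w (hw.trans_le hl)

theorem Good.add (h : Good R k Φ) (h' : Good R k Ψ) : Good R k fun t => Φ t + Ψ t := by
  intro w hw
  simp only [map_add, Complex.ofReal_add]
  exact add_mem (h w hw) (h' w hw)

theorem good_of_mem_pow (h : ∀ t, Φ t ∈ maxIdeal d ^ k) : Good R k Φ := by
  intro w hw
  simp only [fun t => (mem_pow_iff k).1 (h t) w hw, Complex.ofReal_zero]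
  exact zero_mem R

theorem good_const (φ : SmoothGerm d) : Good R k fun _ : T => φ := fun w _ =>
  R.algebraMap_mem ((jet w φ : ℂ))

theorem Good.sum {ι : Type*} (s : Finset ι) {Φ : ι → T → SmoothGerm d}
    (h : ∀ i ∈ s, Good R k (Φ i)) : Good R k fun t => ∑ i ∈ s, Φ i t := by
  intro w hw
  simp only [map_sum, Complex.ofReal_sum]
  have := sum_mem (S := R) fun i hi => h i hi w hw
  convert this using 1
  ext t
  simp

theorem Good.mul (h : Good R k Φ) (h' : Good R k Ψ) : Good R k fun t => Φ t * Ψ t := by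
  induction k generalizing Φ Ψ with
  | zero => exact good_zero
  | succ k ih =>
    have h1 := good_succ.1 h
    have h2 := good_succ.1 h'
    refine good_succ.2 ⟨?_, fun i => ?_⟩
    · simp only [map_mul, Complex.ofReal_mul]
      exact mul_mem h1.1 h2.1
    · simp only [pderiv_mul]
      exact (ih (h1.2 i) (h'.mono (Nat.le_succ k))).add (ih (h.mono (Nat.le_succ k)) (h2.2 i))

/-- In the Leibniz rule the top derivative of `Φ` is multiplied by the value of `Ψ`, which is zero.
-/
theorem Good.mul_of_mem_right (h : Good R k Φ) (h' : Good R (k + 1) Ψ)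
    (hΨ : ∀ t, Ψ t ∈ maxIdeal d) : Good R (k + 1) fun t => Φ t * Ψ t := by
  induction k generalizing Φ Ψ with
  | zero =>
    refine good_of_mem_pow fun t => ?_
    rw [zero_add, pow_one]
    exact Ideal.mul_mem_left _ _ (hΨ t)
  | succ k ih =>
    refine good_succ.2 ⟨?_, fun i => ?_⟩
    · simp only [map_mul, mem_maxIdeal.1 (hΨ _), mul_zero, Complex.ofReal_zero]
      exact zero_mem R
    · simp only [pderiv_mul]
      exact (ih ((good_succ.1 h).2 i) (h'.mono (Nat.le_succ _)) hΨ).add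
        (h.mul ((good_succ.1 h').2 i))

/-- Both top-order terms in the Leibniz rule disappear, so one order is gained. This gain drives the
induction on the jet order in `goodMap_of_system`. -/
theorem Good.mul_of_mem (h : Good R k Φ) (h' : Good R k Ψ) (hΦ : ∀ t, Φ t ∈ maxIdeal d)
    (hΨ : ∀ t, Ψ t ∈ maxIdeal d) : Good R (k + 1) fun t => Φ t * Ψ t := by
  refine good_succ.2 ⟨?_, fun i => ?_⟩
  · simp only [map_mul, mem_maxIdeal.1 (hΨ _), mul_zero, Complex.ofReal_zero]
    exact zero_mem R
  · simp only [pderiv_mul]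
    cases k with
    | zero => exact good_zero
    | succ k =>
      refine (((good_succ.1 h).2 i).mul_of_mem_right h' hΨ).add ?_
      simp only [mul_comm (Φ _)]
      exact ((good_succ.1 h').2 i).mul_of_mem_right h hΦ

theorem Good.pullback {F : T → SelfMapGerm d}
    (hF : ∀ j, Good R k fun t => pullback (F t) (coord j)) (h : Good R k Φ) :
    Good R k fun t => pullback (F t) (Φ t) := by
  induction k generalizing Φ with
  | zero => exact good_zero
  | succ k ih =>
    refine good_succ.2 ⟨?_, fun i => ?_⟩
    · simp only [ev_pullback]
      exact (good_succ.1 h).1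
    · rw [funext fun t => pderiv_pullback i (F t) (Φ t)]
      exact Good.sum _ fun j _ => ((good_succ.1 (hF j)).2 i).mul
        (ih (fun j => (hF j).mono (Nat.le_succ k)) ((good_succ.1 h).2 j))

/-- A family of germs of maps whose jets are functions that belong to the algebra `R`. -/
def GoodMap (R : Subalgebra ℂ (T → ℂ)) (F : T → SelfMapGerm d) : Prop :=
  ∀ k j, Good R k fun t => SmoothLocal.pullback (F t) (coord j)

theorem GoodMap.mul {F H : T → SelfMapGerm d} (hF : GoodMap R F) (hH : GoodMap R H) :
    GoodMap R fun t => F t * H t := by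
  intro k j
  simp only [pullback_mul]
  exact (hF k j).pullback (hH k)

theorem goodMap_one : GoodMap R fun _ : T => (1 : SelfMapGerm d) := by
  intro k j
  exact good_const _

theorem GoodMap.comp {T' : Type*} {R' : Subalgebra ℂ (T' → ℂ)} {F : T → SelfMapGerm d}
    (hF : GoodMap R F) {π : T' → T} (hπ : ∀ f ∈ R, f ∘ π ∈ R') : GoodMap R' (F ∘ π) :=
  fun k j w hw => hπ _ (hF k j w hw)

end Good

/-! ### Linear systems with triangular solution spaces -/

section Solve

variable {T : Type*} (Γ : Submodule ℂ ((T → ℂ) × (T → ℂ)))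

/-- `Γ` plays the graph of an operator `A` (shift or differentiation, the latter only partially
defined), and `(A - l) u = e j` is solved where `A` is triangular with diagonal entry `c`. Off
resonance, divide by `c - l` and correct by earlier solutions; if `c = l`, start from `e (j + 1)`,
whose image under `A - l` has leading coefficient `b (j + 1) j ≠ 0`. -/
theorem exists_solution (e : ℕ → T → ℂ) (c : ℂ) (b : ℕ → ℕ → ℂ) (hb : ∀ j, b (j + 1) j ≠ 0)
    (he : ∀ j, (e j, c • e j + ∑ i ∈ Finset.range j, b j i • e i) ∈ Γ) (l : ℂ) (j : ℕ) :
    ∃ u ∈ Submodule.span ℂ (Set.range e), (u, l • u + e j) ∈ Γ := by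
  induction j using Nat.strong_induction_on with
  | _ j ih =>
    choose! s hs hsΓ using ih
    have he' : ∀ i, e i ∈ Submodule.span ℂ (Set.range e) := fun i => Submodule.subset_span ⟨i, rfl⟩
    have key : ∀ (n : ℕ), (∀ i ∈ Finset.range n, i < j) → ∀ β : ℕ → ℂ,
        (∑ i ∈ Finset.range n, β i • s i, l • ∑ i ∈ Finset.range n, β i • s i +
          ∑ i ∈ Finset.range n, β i • e i) ∈ Γ := by
      intro n hn β
      have := sum_mem (S := Γ) fun i hi => Γ.smul_mem (β i) (hsΓ i (hn i hi))
      convert this using 1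
      refine Prod.ext ?_ ?_
      · simp only [Prod.smul_mk, Prod.fst_sum]
      · simp only [Prod.smul_mk, Prod.snd_sum, smul_add, Finset.sum_add_distrib, Finset.smul_sum,
          smul_comm l]
    by_cases hcl : c = l
    · subst hcl
      have h1 := Γ.sub_mem (he (j + 1)) (key j (by simp) (b (j + 1)))
      refine ⟨(b (j + 1) j)⁻¹ • (e (j + 1) - ∑ i ∈ Finset.range j, b (j + 1) i • s i),
        Submodule.smul_mem _ _ (sub_mem (he' _) (sum_mem fun i hi =>
          Submodule.smul_mem _ _ (hs i (by simpa using hi)))), ?_⟩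
      have h2 := Γ.smul_mem (b (j + 1) j)⁻¹ h1
      convert h2 using 1
      rw [Prod.mk_sub_mk, Prod.smul_mk, Finset.sum_range_succ]
      congr 1
      have : e j = (b (j + 1) j)⁻¹ • b (j + 1) j • e j := by rw [inv_smul_smul₀ (hb j)]
      nth_rewrite 1 [this]
      rw [smul_comm c, ← smul_add]
      congr 1
      rw [smul_sub]
      abel
    · have hcl' : c - l ≠ 0 := sub_ne_zero.2 hcl
      have h1 := Γ.sub_mem (he j) (key j (by simp) (b j))
      refine ⟨(c - l)⁻¹ • (e j - ∑ i ∈ Finset.range j, b j i • s i),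
        Submodule.smul_mem _ _ (sub_mem (he' _) (sum_mem fun i hi =>
          Submodule.smul_mem _ _ (hs i (by simpa using hi)))), ?_⟩
      have h2 := Γ.smul_mem (c - l)⁻¹ h1
      convert h2 using 1
      rw [Prod.mk_sub_mk, Prod.smul_mk]
      congr 1
      have : e j = (c - l)⁻¹ • (c - l) • e j := by rw [inv_smul_smul₀ hcl']
      nth_rewrite 2 [this]
      rw [smul_comm l, ← smul_add]
      congr 1
      rw [smul_sub, sub_smul]
      abel

theorem exists_eq_pow_mul_of_mem_closure {M : Type*} [CommMonoid M] {x : M} {X : Set M} {f : M}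
    (hf : f ∈ Submonoid.closure (insert x X)) :
    ∃ j : ℕ, ∃ χ ∈ Submonoid.closure X, f = x ^ j * χ := by
  induction hf using Submonoid.closure_induction with
  | mem y hy =>
    rcases hy with rfl | hy
    · exact ⟨1, 1, one_mem _, by simp⟩
    · exact ⟨0, y, Submonoid.subset_closure hy, by simp⟩
  | one => exact ⟨0, 1, one_mem _, by simp⟩
  | mul y z _ _ hy hz =>
    obtain ⟨j, χ, hχ, rfl⟩ := hy
    obtain ⟨j', χ', hχ', rfl⟩ := hz
    exact ⟨j + j', χ * χ', mul_mem hχ hχ', by rw [pow_add, mul_mul_mul_comm]⟩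

theorem mem_adjoin_of_solution {x : T → ℂ} {X : Set (T → ℂ)} {l : ℂ}
    (hX : ∀ χ ∈ Submonoid.closure X, ∃ (c : ℂ) (b : ℕ → ℕ → ℂ), (∀ j, b (j + 1) j ≠ 0) ∧
      ∀ j, (x ^ j * χ, c • (x ^ j * χ) + ∑ i ∈ Finset.range j, b j i • (x ^ i * χ)) ∈ Γ)
    (hker : ∀ u, (u, l • u) ∈ Γ → u ∈ Algebra.adjoin ℂ (insert x X))
    {u v : T → ℂ} (hv : v ∈ Algebra.adjoin ℂ (insert x X)) (huv : (u, l • u + v) ∈ Γ) :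
    u ∈ Algebra.adjoin ℂ (insert x X) := by
  have hsol : ∃ u₀ ∈ Algebra.adjoin ℂ (insert x X), (u₀, l • u₀ + v) ∈ Γ := by
    clear huv
    rw [← Subalgebra.mem_toSubmodule, Algebra.adjoin_eq_span] at hv
    induction hv using Submodule.span_induction with
    | mem y hy =>
      obtain ⟨j, χ, hχ, rfl⟩ := exists_eq_pow_mul_of_mem_closure hy
      obtain ⟨c, b, hb, he⟩ := hX χ hχ
      obtain ⟨s, hs, hsΓ⟩ := exists_solution Γ (fun j => x ^ j * χ) c b hb he l j
      refine ⟨s, ?_, hsΓ⟩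
      refine (Submodule.span_le
        (p := Subalgebra.toSubmodule (Algebra.adjoin ℂ (insert x X)))).2 ?_ hs
      rintro _ ⟨i, rfl⟩
      change _ ∈ Algebra.adjoin ℂ (insert x X)
      refine mul_mem (pow_mem (Algebra.subset_adjoin (Set.mem_insert _ _)) i) ?_
      exact (Submonoid.closure_le (S := (Algebra.adjoin ℂ (insert x X)).toSubmonoid)).2
        ((Set.subset_insert _ _).trans Algebra.subset_adjoin) hχ
    | zero => exact ⟨0, zero_mem _, by rw [smul_zero, zero_add]; exact Γ.zero_mem⟩
    | add y z _ _ hy hz =>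
      obtain ⟨s, hs, hsΓ⟩ := hy
      obtain ⟨s', hs', hsΓ'⟩ := hz
      refine ⟨s + s', add_mem hs hs', ?_⟩
      have := Γ.add_mem hsΓ hsΓ'
      rwa [Prod.mk_add_mk, add_add_add_comm, ← smul_add] at this
    | smul a y _ hy =>
      obtain ⟨s, hs, hsΓ⟩ := hy
      refine ⟨a • s, Subalgebra.smul_mem _ hs a, ?_⟩
      have := Γ.smul_mem a hsΓ
      rwa [Prod.smul_mk, smul_add, smul_comm] at this
  -- The difference from a particular solution solves the homogeneous equation, which `hker`
  -- controls.
  obtain ⟨u₀, hu₀, h0⟩ := hsol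
  have h1 := Γ.sub_mem huv h0
  rw [Prod.mk_sub_mk, add_sub_add_right_eq_sub, ← smul_sub] at h1
  have := add_mem (hker _ h1) hu₀
  rwa [sub_add_cancel] at this

/-- Combining the unknowns with the entries of a generalised left eigenvector of `a` reduces the
system to scalar equations, solved up the filtration of the generalised eigenspace. Over `ℂ` these
spaces span, so every unknown is recovered. -/
theorem mem_of_linear_system {n : ℕ} {R : Subalgebra ℂ (T → ℂ)} (a : Matrix (Fin n) (Fin n) ℂ)
    (hR : ∀ l, Module.End.HasEigenvalue (Matrix.vecMulLinear a) l → ∀ u v, v ∈ R →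
      (u, l • u + v) ∈ Γ → u ∈ R)
    (u r : Fin n → T → ℂ) (hr : ∀ i, r i ∈ R)
    (hu : ∀ i, (u i, ∑ j, a i j • u j + r i) ∈ Γ) (i : Fin n) : u i ∈ R := by
  let f : Module.End ℂ (Fin n → ℂ) := Matrix.vecMulLinear a
  let L : (Fin n → ℂ) →ₗ[ℂ] (T → ℂ) := Fintype.linearCombination ℂ u
  let L' : (Fin n → ℂ) →ₗ[ℂ] (T → ℂ) := Fintype.linearCombination ℂ r
  have hL : ∀ c, L c = ∑ i, c i • u i := fun c => Fintype.linearCombination_apply ℂ u c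
  have hL' : ∀ c, L' c = ∑ i, c i • r i := fun c => Fintype.linearCombination_apply ℂ r c
  have hf : ∀ c j, f c j = ∑ i, c i * a i j := fun c j => rfl
  have hrc : ∀ c, L' c ∈ R := fun c => by
    rw [hL']; exact sum_mem fun i _ => R.smul_mem (hr i) _
  have hΓ : ∀ c, (L c, L (f c) + L' c) ∈ Γ := by
    intro c
    have := sum_mem (S := Γ) (t := Finset.univ) fun i _ => Γ.smul_mem (c i) (hu i)
    convert this using 1
    refine Prod.ext ?_ ?_
    · simp only [Prod.smul_mk, Prod.fst_sum, hL]
    · simp only [Prod.smul_mk, Prod.snd_sum, smul_add, Finset.sum_add_distrib, hL, hL', hf,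
        Finset.smul_sum, Finset.sum_smul, smul_smul]
      rw [Finset.sum_comm]
  have hgen : ∀ (l : ℂ) (k : ℕ) c, c ∈ LinearMap.ker ((f - l • 1) ^ k) → L c ∈ R := by
    intro l k
    induction k with
    | zero =>
      intro c hc
      have : c = 0 := by simpa using hc
      rw [this, map_zero]; exact zero_mem R
    | succ k ih =>
      intro c hc
      by_cases hc0 : c = 0
      · rw [hc0, map_zero]; exact zero_mem R
      have hev : Module.End.HasEigenvalue f l := by
        refine Module.End.hasEigenvalue_of_hasGenEigenvalue (k := k + 1) fun hbot => hc0 ?_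
        have : c ∈ f.genEigenspace l (k + 1 : ℕ) := by
          rw [Module.End.mem_genEigenspace_nat]; exact hc
        rw [hbot] at this
        simpa using this
      have h1 : L ((f - l • 1) c) ∈ R := ih _ (by
        rw [LinearMap.mem_ker, pow_succ] at hc
        exact hc)
      refine hR l hev (L c) (L ((f - l • 1) c) + L' c) (add_mem h1 (hrc c)) ?_
      convert hΓ c using 2
      rw [← add_assoc, ← map_smul, ← map_add]
      congr 2
      simp
  have htop : (⊤ : Submodule ℂ (Fin n → ℂ)) ≤ (Subalgebra.toSubmodule R).comap L := by
    rw [← Module.End.iSup_maxGenEigenspace_eq_top f]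
    refine iSup_le fun l c hc => ?_
    obtain ⟨k, hk⟩ := Module.End.mem_maxGenEigenspace f l c |>.1 hc
    exact hgen l k c hk
  have := htop (Submodule.mem_top (x := Pi.single i 1))
  simpa [L] using this

/-- Since `r i` is quadratic, jets of order `k` of its pullback involve only lower jets of `F t`,
which are in `R` by induction; the jets of order `k` of `F t` then solve a linear system with matrix
`a` and right-hand side in `R`. -/
theorem goodMap_of_system {d : ℕ} {R : Subalgebra ℂ (T → ℂ)} (F : T → SelfMapGerm d)
    (a : Matrix (Fin d) (Fin d) ℝ) (r : Fin d → SmoothGerm d)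
    (hr : ∀ i, r i ∈ maxIdeal d * maxIdeal d)
    (hR : ∀ l, Module.End.HasEigenvalue (Matrix.vecMulLinear (a.map (fun x => (x : ℂ)))) l →
      ∀ u v, v ∈ R → (u, l • u + v) ∈ Γ → u ∈ R)
    (hF : ∀ i w, ((fun t => (jet w (pullback (F t) (coord i)) : ℂ)),
      (fun t => (jet w (pullback (F t) (∑ j, a i j • coord j + r i)) : ℂ))) ∈ Γ) :
    GoodMap R F := by
  intro k
  induction k with
  | zero => intro j; exact good_zero
  | succ k ih =>
    have hr' : ∀ i, Good R (k + 1) fun t => pullback (F t) (r i) := by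
      intro i
      refine Submodule.mul_induction_on (hr i) (fun f hf g hg => ?_) (fun f g hf hg => ?_)
      · simp only [map_mul]
        refine Good.mul_of_mem ((good_const f).pullback ih) ((good_const g).pullback ih) ?_ ?_
        · intro t; rw [mem_maxIdeal, ev_pullback]; exact hf
        · intro t; rw [mem_maxIdeal, ev_pullback]; exact hg
      · simp only [map_add]
        exact hf.add hg
    intro j w hw
    refine mem_of_linear_system Γ _ hR (fun i t => (jet w (pullback (F t) (coord i)) : ℂ))
      (fun i t => (jet w (pullback (F t) (r i)) : ℂ)) (fun i => hr' i w hw) (fun i => ?_) j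
    convert hF i w using 2
    ext t
    simp [pullback_smul]

end Solve

theorem exists_linear_part {d : ℕ} {φ : SmoothGerm d} (hφ : φ ∈ maxIdeal d) :
    φ - ∑ j, ev d (pderiv j φ) • coord j ∈ maxIdeal d * maxIdeal d := by
  rw [← pow_two, mem_pow_iff]
  rintro (_ | ⟨i, _ | ⟨i', w⟩⟩) hw
  · have : ev d φ = 0 := hφ
    simp [this, ev_coord]
  · simp [pderiv_coord]
  · simp at hw

/-! ### Iterates of a germ of a diffeomorphism -/

/-- The graph of the shift operator on sequences. -/
def shiftGraph : Submodule ℂ ((ℕ → ℂ) × (ℕ → ℂ)) where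
  carrier := {p | ∀ n, p.2 n = p.1 (n + 1)}
  add_mem' {p q} hp hq n := by
    rw [Prod.fst_add, Prod.snd_add, Pi.add_apply, Pi.add_apply, hp n, hq n]
  zero_mem' _ := rfl
  smul_mem' c p hp n := by
    rw [Prod.smul_fst, Prod.smul_snd, Pi.smul_apply, Pi.smul_apply, hp n]

theorem mem_closure_range_pow {S : Set ℂ} (hS : ∀ l ∈ S, l ≠ 0) {χ : ℕ → ℂ}
    (hχ : χ ∈ Submonoid.closure ((fun (l : ℂ) (n : ℕ) => l ^ n) '' S)) :
    ∃ c : ℂ, c ≠ 0 ∧ χ = fun n => c ^ n := by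
  induction hχ using Submonoid.closure_induction with
  | mem y hy =>
    obtain ⟨l, hl, rfl⟩ := hy
    exact ⟨l, hS l hl, rfl⟩
  | one => exact ⟨1, one_ne_zero, by ext n; simp⟩
  | mul y z _ _ hy hz =>
    obtain ⟨c, hc, rfl⟩ := hy
    obtain ⟨c', hc', rfl⟩ := hz
    exact ⟨c * c', mul_ne_zero hc hc', by ext n; simp [mul_pow]⟩

theorem mem_of_shift_eq {S : Set ℂ} (hS : ∀ l ∈ S, l ≠ 0) {l : ℂ} (hl : l ∈ S) {u v : ℕ → ℂ}
    (hv : v ∈ Algebra.adjoin ℂ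
      (insert (fun n : ℕ => (n : ℂ)) ((fun (l : ℂ) (n : ℕ) => l ^ n) '' S)))
    (huv : (u, l • u + v) ∈ shiftGraph) :
    u ∈ Algebra.adjoin ℂ
      (insert (fun n : ℕ => (n : ℂ)) ((fun (l : ℂ) (n : ℕ) => l ^ n) '' S)) := by
  refine mem_adjoin_of_solution shiftGraph (fun χ hχ => ?_) (fun u hu => ?_) hv huv
  · obtain ⟨c, hc, rfl⟩ := mem_closure_range_pow hS hχ
    -- The coefficients come from the binomial expansion of `(n + 1) ^ j * c ^ (n + 1)`; the
    -- subdiagonal entry `c * (j + 1)` is nonzero because `c ≠ 0`, which is where invertibility of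
    -- the germ is needed.
    refine ⟨c, fun j i => c * (j.choose i : ℂ), fun j => ?_, fun j n => ?_⟩
    · refine mul_ne_zero hc ?_
      rw [Nat.choose_succ_self_right]
      exact_mod_cast Nat.succ_ne_zero j
    · simp only [Pi.add_apply, Pi.smul_apply, Pi.mul_apply, Pi.pow_apply, Finset.sum_apply,
        smul_eq_mul, Nat.cast_add, Nat.cast_one]
      rw [add_pow, Finset.sum_range_succ, add_mul, Finset.sum_mul, add_comm]
      simp only [Nat.choose_self, one_pow, mul_one, Nat.cast_one]
      congr 1
      · exact Finset.sum_congr rfl fun i _ => by ring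
      · ring
  · have : u = u 0 • fun n : ℕ => l ^ n := by
      ext n
      induction n with
      | zero => simp
      | succ n ih =>
        have := hu n
        simp only [Pi.smul_apply, smul_eq_mul] at this ih ⊢
        rw [← this, ih]
        ring
    rw [this]
    exact Subalgebra.smul_mem _ (Algebra.subset_adjoin
      (Set.mem_insert_of_mem _ (Set.mem_image_of_mem _ hl))) _

/-- The Jacobian matrix at the origin of a germ of a self-map. -/
def jacobian {d : ℕ} (F : SelfMapGerm d) : Matrix (Fin d) (Fin d) ℝ :=
  Matrix.of fun i j => ev d (pderiv j (pullback F (coord i)))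

theorem jacobian_mul {d : ℕ} (F H : SelfMapGerm d) :
    jacobian (F * H) = jacobian F * jacobian H := by
  ext i k
  simp only [jacobian, Matrix.of_apply, Matrix.mul_apply, pullback_mul]
  rw [pderiv_pullback, map_sum]
  exact Finset.sum_congr rfl fun j _ => by rw [map_mul, ev_pullback, mul_comm]

theorem jacobian_one {d : ℕ} : jacobian (1 : SelfMapGerm d) = 1 := by
  ext i j
  simp only [jacobian, Matrix.of_apply, pullback_one, pderiv_coord, Matrix.one_apply]
  rw [apply_ite (ev d), map_one, map_zero]
  simp only [eq_comm]

theorem eigenvalue_jacobian_ne_zero {d : ℕ} (F : DiffGerm d) {l : ℂ}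
    (hl : Module.End.HasEigenvalue
      (Matrix.vecMulLinear ((jacobian F.val).map (fun x => (x : ℂ)))) l) : l ≠ 0 := by
  rintro rfl
  obtain ⟨c, hc⟩ := hl.exists_hasEigenvector
  have h0 : Matrix.vecMul c ((jacobian F.val).map (fun x => (x : ℂ))) = 0 := by
    have := hc.apply_eq_smul
    rwa [zero_smul] at this
  have h1 : (jacobian F.val).map (fun x => (x : ℂ)) *
      (jacobian F.inv).map (fun x => (x : ℂ)) = 1 := by
    have := congrArg (fun A : Matrix (Fin d) (Fin d) ℝ => A.map Complex.ofRealHom)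
      ((jacobian_mul F.val F.inv).symm.trans ((congrArg jacobian F.val_inv).trans jacobian_one))
    simp only [Matrix.map_mul] at this
    refine this.trans (Matrix.map_one _ (map_zero _) (map_one _))
  refine hc.2 ?_
  rw [← Matrix.vecMul_one c, ← h1, ← Matrix.vecMul_vecMul, h0, Matrix.zero_vecMul]

theorem exists_goodMap_pow {d : ℕ} (F : DiffGerm d) :
    ∃ X : Set (ℕ → ℂ), X.Finite ∧ GoodMap (Algebra.adjoin ℂ X) fun n => (F ^ n).val := by
  let f : Module.End ℂ (Fin d → ℂ) :=
    Matrix.vecMulLinear ((jacobian F.val).map (fun x => (x : ℂ)))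
  let S : Set ℂ := {l | f.HasEigenvalue l}
  refine ⟨insert (fun n : ℕ => (n : ℂ)) ((fun (l : ℂ) (n : ℕ) => l ^ n) '' S),
    ((Module.End.finite_hasEigenvalue f).image _).insert _, ?_⟩
  refine goodMap_of_system shiftGraph _ (jacobian F.val)
    (fun i => pullback F.val (coord i) - ∑ j, jacobian F.val i j • coord j)
    (fun i => exists_linear_part (by rw [mem_maxIdeal, ev_pullback, ev_coord]))
    (fun l hl u v hv huv => mem_of_shift_eq (fun l hl => eigenvalue_jacobian_ne_zero F hl) hl hv
      huv) (fun i w n => ?_)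
  simp only [add_sub_cancel]
  -- Splitting off `F` on the left leaves the pullback by `F ^ n` outermost, applied to the fixed
  -- germ `F^* x_i`; this is the recurrence.
  rw [pow_succ', Units.val_mul, pullback_mul]

/-! ### One-parameter families satisfying an autonomous differential equation -/

/-- The graph of the differentiation operator on functions of a real variable. -/
def derivGraph : Submodule ℂ ((ℝ → ℂ) × (ℝ → ℂ)) where
  carrier := {p | ∀ t, HasDerivAt p.1 (p.2 t) t}
  add_mem' hp hq t := (hp t).add (hq t)
  zero_mem' t := hasDerivAt_const t (0 : ℂ)
  smul_mem' c _ hp t := (hp t).const_smul c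

theorem mem_closure_range_exp {S : Set ℂ} {χ : ℝ → ℂ}
    (hχ : χ ∈ Submonoid.closure ((fun (l : ℂ) (t : ℝ) => Complex.exp (l * t)) '' S)) :
    ∃ c : ℂ, χ = fun t : ℝ => Complex.exp (c * t) := by
  induction hχ using Submonoid.closure_induction with
  | mem y hy =>
    obtain ⟨l, hl, rfl⟩ := hy
    exact ⟨l, rfl⟩
  | one => exact ⟨0, by ext n; simp⟩
  | mul y z _ _ hy hz =>
    obtain ⟨c, rfl⟩ := hy
    obtain ⟨c', rfl⟩ := hz
    exact ⟨c + c', by ext n; simp [add_mul, Complex.exp_add]⟩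

theorem hasDerivAt_exp_mul (c : ℂ) (t : ℝ) :
    HasDerivAt (fun t : ℝ => Complex.exp (c * t)) (c * Complex.exp (c * t)) t := by
  have h1 : HasDerivAt (fun t : ℝ => c * (t : ℂ)) c t := by
    simpa using (Complex.ofRealCLM.hasDerivAt (x := t)).const_mul c
  simpa [mul_comm] using h1.cexp

theorem mem_of_deriv_eq {S : Set ℂ} {l : ℂ} (hl : l ∈ S) {u v : ℝ → ℂ}
    (hv : v ∈ Algebra.adjoin ℂ
      (insert (fun t : ℝ => (t : ℂ)) ((fun (l : ℂ) (t : ℝ) => Complex.exp (l * t)) '' S)))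
    (huv : (u, l • u + v) ∈ derivGraph) :
    u ∈ Algebra.adjoin ℂ
      (insert (fun t : ℝ => (t : ℂ)) ((fun (l : ℂ) (t : ℝ) => Complex.exp (l * t)) '' S)) := by
  refine mem_adjoin_of_solution derivGraph (fun χ hχ => ?_) (fun u hu => ?_) hv huv
  · obtain ⟨c, rfl⟩ := mem_closure_range_exp hχ
    -- Read off from the derivative of `t ^ j * exp (c * t)`.
    refine ⟨c, fun j i => if i + 1 = j then (j : ℂ) else 0, fun j => ?_, fun j t => ?_⟩
    · simp only [if_true]
      exact_mod_cast Nat.succ_ne_zero j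
    · have h1 : HasDerivAt (fun t : ℝ => (t : ℂ) ^ j) ((j : ℂ) * (t : ℂ) ^ (j - 1)) t := by
        simpa using (Complex.ofRealCLM.hasDerivAt (x := t)).fun_pow j
      have h2 := h1.mul (hasDerivAt_exp_mul c t)
      refine h2.congr_deriv ?_
      simp only [Pi.add_apply, Pi.smul_apply, Pi.mul_apply, Pi.pow_apply, Finset.sum_apply,
        smul_eq_mul]
      cases j with
      | zero => simp
      | succ j =>
        rw [Finset.sum_range_succ, Finset.sum_eq_zero fun i hi => by
          rw [if_neg (by have := Finset.mem_range.1 hi; omega), zero_mul]]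
        simp only [if_true, Nat.add_sub_cancel]
        ring
  -- Integrating factor for `u' = l u`.
  · have hd : ∀ t, HasDerivAt (fun t : ℝ => u t * Complex.exp (-l * t)) 0 t := by
      intro t
      refine ((hu t).mul (hasDerivAt_exp_mul (-l) t)).congr_deriv ?_
      simp only [Pi.smul_apply, smul_eq_mul]
      ring
    have hc : ∀ t, u t * Complex.exp (-l * t) = u 0 := by
      intro t
      have := is_const_of_deriv_eq_zero (fun t => (hd t).differentiableAt)
        (fun t => (hd t).deriv) t 0
      simpa using this
    have : u = u 0 • fun t : ℝ => Complex.exp (l * t) := by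
      ext t
      rw [Pi.smul_apply, smul_eq_mul, ← hc t, mul_assoc, ← Complex.exp_add]
      simp
    rw [this]
    exact Subalgebra.smul_mem _ (Algebra.subset_adjoin
      (Set.mem_insert_of_mem _ (Set.mem_image_of_mem _ hl))) _

theorem exists_goodMap_of_hasDerivAt {d : ℕ} (F : ℝ → SelfMapGerm d) (v : Fin d → SmoothGerm d)
    (hv : ∀ i, v i ∈ maxIdeal d)
    (hF : ∀ i w t, HasDerivAt (fun t => jet w (pullback (F t) (coord i)))
      (jet w (pullback (F t) (v i))) t) :
    ∃ X : Set (ℝ → ℂ), X.Finite ∧ GoodMap (Algebra.adjoin ℂ X) F := by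
  let a : Matrix (Fin d) (Fin d) ℝ := Matrix.of fun i j => ev d (pderiv j (v i))
  let f : Module.End ℂ (Fin d → ℂ) := Matrix.vecMulLinear (a.map (fun x => (x : ℂ)))
  let S : Set ℂ := {l | f.HasEigenvalue l}
  refine ⟨insert (fun t : ℝ => (t : ℂ)) ((fun (l : ℂ) (t : ℝ) => Complex.exp (l * t)) '' S),
    ((Module.End.finite_hasEigenvalue f).image _).insert _, ?_⟩
  refine goodMap_of_system derivGraph _ a
    (fun i => v i - ∑ j, a i j • coord j) (fun i => exists_linear_part (hv i))
    (fun l hl u v hv huv => mem_of_deriv_eq hl hv huv) (fun i w t => ?_)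
  simp only [add_sub_cancel]
  exact (hF i w t).ofReal_comp

/-! ### Jets of families depending smoothly on a parameter -/

theorem coe_pderiv {d : ℕ} (i : Fin d) {φ : SmoothGerm d} {f : E d → ℝ}
    (h : φ.1 = (f : Germ (𝓝 (0 : E d)) ℝ)) :
    (pderiv i φ).1 = ((fun x => fderiv ℝ f x (Pi.single i 1) : E d → ℝ) :
      Germ (𝓝 (0 : E d)) ℝ) := by
  obtain ⟨u, hu, rfl⟩ := exists_eq_toGerm φ
  have h' : u =ᶠ[𝓝 0] f := Germ.coe_eq.1 h
  rw [pderiv_toGerm]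
  refine Germ.coe_eq.2 ?_
  filter_upwards [h'.fderiv (𝕜 := ℝ)] with x hx
  rw [hx]

theorem eventually_slice {d : ℕ} {t : ℝ} {P : ℝ × E d → Prop}
    (h : ∀ᶠ p in 𝓝 (t, (0 : E d)), P p) : ∀ᶠ x in 𝓝 (0 : E d), P (t, x) :=
  (Continuous.prodMk_right t).continuousAt.eventually h

theorem contDiffAt_fderiv_apply {V W : Type*} [NormedAddCommGroup V] [NormedSpace ℝ V]
    [NormedAddCommGroup W] [NormedSpace ℝ W] {f : V → W} {x : V} (hf : ContDiffAt ℝ ∞ f x)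
    (v : V) : ContDiffAt ℝ ∞ (fun x => fderiv ℝ f x v) x :=
  (hf.fderiv_right (m := ∞) (by simp)).clm_apply contDiffAt_const

theorem hasDerivAt_slice {V : Type*} [NormedAddCommGroup V] [NormedSpace ℝ V] {H : ℝ × V → ℝ}
    {p : ℝ × V} (hH : DifferentiableAt ℝ H p) :
    HasDerivAt (fun s => H (s, p.2)) (fderiv ℝ H p (1, 0)) p.1 := by
  have h1 : HasDerivAt (fun s : ℝ => (s, p.2)) ((1 : ℝ), (0 : V)) p.1 :=
    (hasDerivAt_id p.1).prodMk (hasDerivAt_const p.1 p.2)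
  exact HasFDerivAt.comp_hasDerivAt (x := p.1) (hl := hH.hasFDerivAt) (hf := h1)

theorem coe_pderiv_slice {d : ℕ} (i : Fin d) {H : ℝ × E d → ℝ} {t : ℝ}
    (hH : ∀ᶠ p in 𝓝 (t, (0 : E d)), ContDiffAt ℝ ∞ H p) {φ : SmoothGerm d}
    (h : φ.1 = ((fun x => H (t, x) : E d → ℝ) : Germ (𝓝 (0 : E d)) ℝ)) :
    (pderiv i φ).1 = ((fun x => fderiv ℝ H (t, x) (0, Pi.single i 1) : E d → ℝ) :
      Germ (𝓝 (0 : E d)) ℝ) := by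
  rw [coe_pderiv i h]
  refine Germ.coe_eq.2 ?_
  filter_upwards [eventually_slice hH] with x hx
  have h1 : HasFDerivAt (fun x : E d => (t, x)) (ContinuousLinearMap.inr ℝ ℝ (E d)) x :=
    hasFDerivAt_prodMk_right t x
  have h2 := (hx.differentiableAt (by simp)).hasFDerivAt.comp x h1
  have h3 : fderiv ℝ (fun x => H (t, x)) x = _ := h2.fderiv
  rw [h3]
  rfl

/-- The time derivative commutes with each spatial derivative by symmetry of the second derivative
of `H`, so letters of `w` are peeled off one at a time. -/
theorem hasDerivAt_jet {d : ℕ} (w : List (Fin d)) : ∀ {H H' : ℝ × E d → ℝ}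
    (_ : ∀ t, ∀ᶠ p in 𝓝 (t, (0 : E d)), ContDiffAt ℝ ∞ H p)
    (_ : ∀ t, ∀ᶠ p in 𝓝 (t, (0 : E d)), ContDiffAt ℝ ∞ H' p)
    (_ : ∀ t, ∀ᶠ p in 𝓝 (t, (0 : E d)), HasDerivAt (fun s => H (s, p.2)) (H' p) p.1)
    {Φ Φ' : ℝ → SmoothGerm d}
    (_ : ∀ t, (Φ t).1 = ((fun x => H (t, x) : E d → ℝ) : Germ (𝓝 (0 : E d)) ℝ))
    (_ : ∀ t, (Φ' t).1 = ((fun x => H' (t, x) : E d → ℝ) : Germ (𝓝 (0 : E d)) ℝ)) (t : ℝ),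
    HasDerivAt (fun t => jet w (Φ t)) (jet w (Φ' t)) t := by
  induction w with
  | nil =>
    intro H H' _ _ hD Φ Φ' hΦ hΦ' t
    have h1 : ∀ t, jet [] (Φ t) = H (t, 0) := fun t => by
      change (Φ t).1.value = _
      rw [hΦ t]; rfl
    have h2 : jet [] (Φ' t) = H' (t, 0) := by
      change (Φ' t).1.value = _
      rw [hΦ' t]; rfl
    simp only [h1, h2]
    exact (hD t).self_of_nhds
  | cons i w ih =>
    intro H H' hH hH' hD Φ Φ' hΦ hΦ' t
    have hDH : ∀ t, ∀ᶠ p in 𝓝 (t, (0 : E d)), H' p = fderiv ℝ H p (1, 0) := fun t => by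
      filter_upwards [hH t, hD t] with p h1 h2
      exact h2.unique (hasDerivAt_slice (h1.differentiableAt (by simp)))
    refine ih (H := fun p => fderiv ℝ H p (0, Pi.single i 1))
      (H' := fun p => fderiv ℝ H' p (0, Pi.single i 1)) (fun t => ?_) (fun t => ?_) (fun t => ?_)
      (fun t => coe_pderiv_slice i (hH t) (hΦ t)) (fun t => coe_pderiv_slice i (hH' t) (hΦ' t)) t
    · filter_upwards [hH t] with p hp using contDiffAt_fderiv_apply hp _
    · filter_upwards [hH' t] with p hp using contDiffAt_fderiv_apply hp _
    · filter_upwards [hH t, eventually_eventually_nhds.2 (hDH t)] with p hp hDp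
      have h1 := hasDerivAt_slice ((contDiffAt_fderiv_apply hp
        ((0 : ℝ), (Pi.single i 1 : E d))).differentiableAt (by simp))
      refine h1.congr_deriv ?_
      have hd : DifferentiableAt ℝ (fderiv ℝ H) p :=
        (hp.fderiv_right (m := ∞) (by simp)).differentiableAt (by simp)
      rw [EventuallyEq.fderiv_eq (𝕜 := ℝ) hDp, fderiv_clm_apply hd (differentiableAt_const _),
        fderiv_clm_apply hd (differentiableAt_const _)]
      have hs := (hp.isSymmSndFDerivAt (by simp; norm_cast)).eq (1, 0)
        ((0 : ℝ), (Pi.single i 1 : E d))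
      simpa using hs

/-! ### Local flows -/

theorem IsLocalFlow.tendsto {d : ℕ} {v : E d → E d} {φ : ℝ × E d → E d} (h : IsLocalFlow v φ)
    (t : ℝ) : Tendsto φ (𝓝 (t, 0)) (𝓝 0) := by
  have := (h.smooth t).self_of_nhds.continuousAt.tendsto
  rwa [h.fixes] at this

/-- Germs of families of solutions near an equilibrium are determined by the initial values. -/
theorem eventually_eq_of_ode {d : ℕ} {v : E d → E d} (hv : ContDiffAt ℝ 1 v 0)
    {c c' : ℝ × E d → E d} (hc : ∀ t : ℝ, Tendsto c (𝓝 (t, 0)) (𝓝 0))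
    (hc' : ∀ t : ℝ, Tendsto c' (𝓝 (t, 0)) (𝓝 0))
    (ho : ∀ t : ℝ, ∀ᶠ p in 𝓝 (t, (0 : E d)), HasDerivAt (fun s : ℝ => c (s, p.2)) (v (c p)) p.1)
    (ho' : ∀ t : ℝ, ∀ᶠ p in 𝓝 (t, (0 : E d)),
      HasDerivAt (fun s : ℝ => c' (s, p.2)) (v (c' p)) p.1)
    (h0 : ∀ᶠ x in 𝓝 (0 : E d), c (0, x) = c' (0, x)) (t : ℝ) :
    ∀ᶠ x in 𝓝 (0 : E d), c (t, x) = c' (t, x) := by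
  obtain ⟨K, s, hs, hK⟩ := hv.exists_lipschitzOnWith
  -- Near `(t₀, 0)` both families stay where `v` is Lipschitz, so agreement at one time spreads over
  -- a common interval. The set of times of agreement is therefore open and closed in `ℝ`.
  have hloc : ∀ t₀ : ℝ, ∃ a b : ℝ, t₀ ∈ Set.Ioo a b ∧ ∀ t₁ ∈ Set.Ioo a b, ∀ t₂ ∈ Set.Ioo a b,
      (∀ᶠ x in 𝓝 (0 : E d), c (t₁, x) = c' (t₁, x)) →
      ∀ᶠ x in 𝓝 (0 : E d), c (t₂, x) = c' (t₂, x) := by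
    intro t₀
    have hev := ((ho t₀).and ((hc t₀).eventually hs)).and ((ho' t₀).and ((hc' t₀).eventually hs))
    rw [nhds_prod_eq, eventually_prod_iff] at hev
    obtain ⟨pa, hpa, pb, hpb, hev⟩ := hev
    obtain ⟨a, b, hab, hsub⟩ := mem_nhds_iff_exists_Ioo_subset.1 hpa
    refine ⟨a, b, hab, fun t₁ ht₁ t₂ ht₂ h => ?_⟩
    filter_upwards [h, hpb] with x hx hbx
    exact ODE_solution_unique_of_mem_Ioo (v := fun _ => v) (s := fun _ => s) (K := K)
      (f := fun t => c (t, x)) (g := fun t => c' (t, x)) (fun _ _ => hK) ht₁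
      (fun t ht => (hev (hsub ht) hbx).1) (fun t ht => (hev (hsub ht) hbx).2) hx ht₂
  have hclopen : IsClopen {t : ℝ | ∀ᶠ x in 𝓝 (0 : E d), c (t, x) = c' (t, x)} := by
    constructor
    · rw [← isOpen_compl_iff, isOpen_iff_mem_nhds]
      intro t₀ ht₀
      obtain ⟨a, b, hab, h⟩ := hloc t₀
      filter_upwards [Ioo_mem_nhds hab.1 hab.2] with t₁ ht₁ h1
      exact ht₀ (h t₁ ht₁ t₀ hab h1)
    · rw [isOpen_iff_mem_nhds]
      intro t₀ ht₀
      obtain ⟨a, b, hab, h⟩ := hloc t₀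
      filter_upwards [Ioo_mem_nhds hab.1 hab.2] with t₁ ht₁
      exact h t₀ hab t₁ ht₁ ht₀
  have := hclopen.eq_univ ⟨0, h0⟩
  exact this.ge (Set.mem_univ t)

/-- The germ at the origin of the time-`t` map of a local flow. -/
def IsLocalFlow.germ {d : ℕ} {v : E d → E d} {φ : ℝ × E d → E d} (h : IsLocalFlow v φ) (t : ℝ) :
    SelfMapGerm d :=
  ⟨((fun x : E d => φ (t, x)) : Germ (𝓝 (0 : E d)) (E d)), fun x => φ (t, x), by
    filter_upwards [eventually_slice (h.smooth t)] with x hx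
    exact hx.comp x (contDiffAt_const.prodMk contDiffAt_id), h.fixes t, rfl⟩

theorem IsLocalFlow.germ_eq {d : ℕ} {v : E d → E d} {φ φ' : ℝ × E d → E d}
    (h : IsLocalFlow v φ) (h' : IsLocalFlow v φ') (hv : ContDiffAt ℝ 1 v 0) (t : ℝ) :
    h.germ t = h'.germ t := by
  refine Subtype.ext (Germ.coe_eq.2 ?_)
  refine eventually_eq_of_ode hv h.tendsto h'.tendsto h.ode h'.ode ?_ t
  filter_upwards [h.init, h'.init] with x hx hx'
  rw [hx, hx']

theorem IsLocalFlow.germ_zero {d : ℕ} {v : E d → E d} {φ : ℝ × E d → E d}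
    (h : IsLocalFlow v φ) : h.germ 0 = 1 :=
  Subtype.ext (Germ.coe_eq.2 h.init)

/-- As functions of `t`, both sides solve the same equation with the same value at `t = 0`. -/
theorem IsLocalFlow.germ_add {d : ℕ} {v : E d → E d} {φ : ℝ × E d → E d}
    (h : IsLocalFlow v φ) (hv : ContDiffAt ℝ 1 v 0) (t s : ℝ) :
    h.germ (t + s) = h.germ t * h.germ s := by
  refine Subtype.ext (Germ.coe_eq.2 ?_)
  have h1 : ∀ t : ℝ, Tendsto (fun p : ℝ × E d => (p.1 + s, p.2)) (𝓝 (t, 0)) (𝓝 (t + s, 0)) :=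
    fun t => Continuous.tendsto (by fun_prop : Continuous fun p : ℝ × E d => (p.1 + s, p.2)) (t, 0)
  have h2 : ∀ t : ℝ, Tendsto (fun p : ℝ × E d => (p.1, φ (s, p.2))) (𝓝 (t, 0)) (𝓝 (t, 0)) := by
    intro t
    rw [nhds_prod_eq]
    refine Tendsto.prodMk tendsto_fst ?_
    have h3 : Tendsto (fun x : E d => (s, x)) (𝓝 0) (𝓝 (s, 0)) :=
      (Continuous.prodMk_right s).tendsto 0
    exact ((h.tendsto s).comp h3).comp tendsto_snd
  refine eventually_eq_of_ode (c := fun p => φ (p.1 + s, p.2))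
    (c' := fun p => φ (p.1, φ (s, p.2))) hv (fun t => (h.tendsto _).comp (h1 t))
    (fun t => (h.tendsto _).comp (h2 t)) (fun t => ?_) (fun t => ?_) ?_ t
  · filter_upwards [(h1 t).eventually (h.ode (t + s))] with p hp
    exact HasDerivAt.comp_add_const p.1 s hp
  · filter_upwards [(h2 t).eventually (h.ode t)] with p hp
    exact hp
  · filter_upwards [((h.tendsto s).comp
      ((Continuous.prodMk_right s).tendsto (0 : E d))).eventually h.init] with x hx
    simp only [zero_add]
    exact hx.symm

/-- The one-parameter group of germs of diffeomorphisms given by a local flow. -/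
def IsLocalFlow.hom {d : ℕ} {v : E d → E d} {φ : ℝ × E d → E d}
    (h : IsLocalFlow v φ) (hv : ContDiffAt ℝ 1 v 0) : Multiplicative ℝ →* DiffGerm d :=
  MonoidHom.toHomUnits
    { toFun := fun t => h.germ t.toAdd
      map_one' := h.germ_zero
      map_mul' := fun t s => h.germ_add hv t.toAdd s.toAdd }

theorem IsLocalFlow.exists_goodMap {d : ℕ} {v : E d → E d} {φ : ℝ × E d → E d}
    (h : IsLocalFlow v φ) (hv : ∀ᶠ x in 𝓝 (0 : E d), ContDiffAt ℝ ∞ v x) (v0 : v 0 = 0) :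
    ∃ X : Set (ℝ → ℂ), X.Finite ∧ GoodMap (Algebra.adjoin ℂ X) h.germ := by
  have hvi : ∀ i, ∀ᶠ x in 𝓝 (0 : E d), ContDiffAt ℝ ∞ (fun x => v x i) x := fun i => by
    filter_upwards [hv] with x hx using contDiffAt_pi.1 hx i
  let V : Fin d → SmoothGerm d := fun i =>
    ⟨((fun x => v x i : E d → ℝ) : Germ (𝓝 (0 : E d)) ℝ), _, hvi i, rfl⟩
  refine exists_goodMap_of_hasDerivAt h.germ V (fun i => ?_) (fun i w t => ?_)
  · change v 0 i = 0
    rw [v0]; rfl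
  · refine hasDerivAt_jet w (H := fun p => φ p i) (H' := fun p => v (φ p) i)
      (Φ' := fun t => pullback (h.germ t) (V i))
      (fun t => ?_) (fun t => ?_) (fun t => ?_) (fun t => rfl) (fun t => rfl) t
    · filter_upwards [h.smooth t] with p hp using contDiffAt_pi.1 hp i
    · filter_upwards [h.smooth t, (h.tendsto t).eventually (hvi i)] with p hp hp'
      exact ContDiffAt.comp p hp' hp
    · filter_upwards [h.ode t] with p hp using (hasDerivAt_pi.1 hp) i

/-- By uniqueness one chosen flow accounts for all flow maps of `v`. If there is no local flow,
there are no flow maps either and the trivial homomorphism serves. The last clause keeps the values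
inside a group containing the flow maps. -/
theorem exists_oneParameterGroup {d : ℕ} {v : E d → E d}
    (hv : ∀ᶠ x in 𝓝 (0 : E d), ContDiffAt ℝ ∞ v x) (v0 : v 0 = 0) :
    ∃ (Φ : Multiplicative ℝ →* DiffGerm d) (X : Set (ℝ → ℂ)), X.Finite ∧
      GoodMap (Algebra.adjoin ℂ X) (fun t => (Φ (Multiplicative.ofAdd t)).val) ∧
      (∀ t g, IsFlowMap v t g → Φ (Multiplicative.ofAdd t) = g) ∧
      (∀ t, Φ t = 1 ∨ ∃ s, IsFlowMap v s (Φ t)) := by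
  by_cases hex : ∃ φ, IsLocalFlow v φ
  · obtain ⟨φ, h⟩ := hex
    have hv1 : ContDiffAt ℝ 1 v 0 := hv.self_of_nhds.of_le (by norm_cast)
    obtain ⟨X, hX, hgood⟩ := h.exists_goodMap hv v0
    refine ⟨h.hom hv1, X, hX, hgood, ?_, fun t => Or.inr ⟨t.toAdd, φ, h, rfl⟩⟩
    rintro t g ⟨φ', h', hg⟩
    refine Units.ext ?_
    exact (h.germ_eq h' hv1 t).trans (Subtype.ext hg)
  · refine ⟨1, ∅, Set.finite_empty, goodMap_one, ?_, fun t => Or.inl rfl⟩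
    rintro t g ⟨φ', h', -⟩
    exact absurd ⟨φ', h'⟩ hex

/-! ### Stabilisation -/

/-- Minors are taken against arbitrary functionals instead of a basis, and `ι` may be infinite: only
the membership of the minors in `R` matters, not their number. -/
theorem exists_minors {T ι V : Type*} [AddCommGroup V] [Module ℝ V] [Module.Finite ℝ V]
    {R : Subalgebra ℂ (T → ℂ)} (S : ι → T → V)
    (hS : ∀ (ℓ : V →ₗ[ℝ] ℝ) (i : ι), (fun t => (ℓ (S i t) : ℂ)) ∈ R) (r : ℕ) :
    ∃ D : Set (T → ℂ), D ⊆ R ∧ ∀ t,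
      r ≤ Module.finrank ℝ (Submodule.span ℝ (Set.range fun i => S i t)) ↔
        ∃ f ∈ D, f t ≠ 0 := by
  have hdet : ∀ (s : Fin r → ι) (ℓ : Fin r → V →ₗ[ℝ] ℝ) (t : T),
      (((Matrix.of fun a b => ℓ a (S (s b) t)).det : ℝ) : ℂ) =
        ∑ σ : Equiv.Perm (Fin r), ((Equiv.Perm.sign σ : ℤ) : ℂ) *
          ∏ i, (ℓ (σ i) (S (s i) t) : ℂ) := by
    intro s ℓ t
    rw [Matrix.det_apply']
    push_cast
    rfl
  refine ⟨{f | ∃ (s : Fin r → ι) (ℓ : Fin r → V →ₗ[ℝ] ℝ),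
    f = fun t => (((Matrix.of fun a b => ℓ a (S (s b) t)).det : ℝ) : ℂ)}, ?_, fun t => ?_⟩
  · rintro _ ⟨s, ℓ, rfl⟩
    have h1 : ∑ σ : Equiv.Perm (Fin r), ((Equiv.Perm.sign σ : ℤ) : ℂ) •
        ∏ i, (fun t => (ℓ (σ i) (S (s i) t) : ℂ)) ∈ R :=
      sum_mem fun σ _ => Subalgebra.smul_mem _ (prod_mem fun i _ => hS _ _) _
    rw [SetLike.mem_coe, funext fun t => hdet s ℓ t]
    convert h1 using 1
    ext t
    simp
  constructor
  · intro hr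
    obtain ⟨b, hb, hspan, hli⟩ := exists_linearIndependent ℝ (Set.range fun i => S i t)
    have hbf : Finite b := hli.finite
    have : Fintype b := Fintype.ofFinite b
    rw [← hspan, finrank_span_set_eq_card hli, Set.toFinset_card] at hr
    obtain ⟨e⟩ : Nonempty (Fin r ↪ b) :=
      Function.Embedding.nonempty_of_card_le (by simpa using hr)
    choose s hs using fun a : Fin r => hb (e a).2
    have hli' : LinearIndependent ℝ fun a : Fin r => S (s a) t := by
      simp only [hs]
      exact hli.comp e e.injective
    obtain ⟨g, hg⟩ := LinearMap.exists_leftInverse_of_injective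
      (Fintype.linearCombination ℝ fun a : Fin r => S (s a) t)
      (LinearMap.ker_eq_bot.2 (linearIndependent_iff_injective_fintypeLinearCombination.1 hli'))
    -- The functionals are dual to the chosen independent vectors, so the matrix is the identity.
    refine ⟨_, ⟨s, fun a => LinearMap.proj a ∘ₗ g, rfl⟩, ?_⟩
    have h1 : (Matrix.of fun a b => (LinearMap.proj a ∘ₗ g : V →ₗ[ℝ] ℝ) (S (s b) t)) =
        (1 : Matrix (Fin r) (Fin r) ℝ) := by
      ext a b
      have h2 := congrFun (LinearMap.congr_fun hg (Pi.single b 1)) a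
      simp only [LinearMap.comp_apply, Fintype.linearCombination_apply_single, one_smul] at h2
      simpa [Matrix.one_apply, Pi.single_apply] using h2
    simp only [h1, Matrix.det_one]
    norm_num
  · rintro ⟨_, ⟨s, ℓ, rfl⟩, hne⟩
    have hne' : (Matrix.of fun a b => ℓ a (S (s b) t)).det ≠ 0 := by
      intro h
      exact hne (by simp only [h, Complex.ofReal_zero])
    have hli : LinearIndependent ℝ fun b : Fin r => S (s b) t := by
      refine LinearIndependent.of_comp (LinearMap.pi ℓ) ?_
      exact Matrix.linearIndependent_cols_iff_isUnit.2
        ((Matrix.isUnit_iff_isUnit_det _).2 (isUnit_iff_ne_zero.2 hne'))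
    have h1 := finrank_span_eq_card hli
    rw [Fintype.card_fin] at h1
    rw [← h1]
    refine Submodule.finrank_mono (Submodule.span_mono ?_)
    rintro _ ⟨a, rfl⟩
    exact ⟨s a, rfl⟩

/-- `I k` is the ideal of functions vanishing off `O k`. If `t ∈ O k`, a witness in `D k` lies in `I
k`, which equals `I m` for `k ≥ m`, so its being nonzero at `t` forces `t ∈ O m`. -/
theorem exists_stable {T : Type*} {R : Subalgebra ℂ (T → ℂ)} [IsNoetherianRing R]
    (O : ℕ → Set T) (hO : Monotone O) (D : ℕ → Set (T → ℂ)) (hD : ∀ k, D k ⊆ R)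
    (h : ∀ k t, t ∈ O k ↔ ∃ f ∈ D k, f t ≠ 0) : ∃ m, ∀ k, O k ⊆ O m := by
  let I : ℕ → Ideal R := fun k =>
    { carrier := {f | ∀ t, f.1 t ≠ 0 → t ∈ O k}
      add_mem' := by
        intro f g hf hg t ht
        by_cases h0 : f.1 t = 0
        · exact hg t fun h1 => ht (by simp [h0, h1])
        · exact hf t h0
      zero_mem' := fun t ht => absurd rfl ht
      smul_mem' := by
        intro c f hf t ht
        refine hf t fun h0 => ht ?_
        simp [h0] }
  obtain ⟨m, hm⟩ := monotone_stabilizes_iff_noetherian.2 ‹IsNoetherianRing R›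
    ⟨I, fun k l hkl f hf t ht => hO hkl (hf t ht)⟩
  refine ⟨m, fun k t ht => ?_⟩
  rcases le_total k m with hk | hk
  · exact hO hk ht
  obtain ⟨f, hf, hft⟩ := (h k t).1 ht
  have h1 : (⟨f, hD k hf⟩ : R) ∈ I k := fun t ht => (h k t).2 ⟨f, hf, ht⟩
  have h2 : I m = I k := hm k hk
  rw [← h2] at h1
  exact h1 t hft

theorem isNoetherianRing_adjoin {T : Type*} {X : Set (T → ℂ)} (hX : X.Finite) :
    IsNoetherianRing (Algebra.adjoin ℂ X) := by
  have h : (Algebra.adjoin ℂ X).FG := (Subalgebra.fg_def).2 ⟨X, hX, rfl⟩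
  have := Subalgebra.fg_iff_finiteType _ |>.1 h
  exact Algebra.FiniteType.isNoetherianRing ℂ _

/-! ### Jets of the intersection ideals and the bound along one family -/

theorem Good.functional {d N : ℕ} {T : Type*} {R : Subalgebra ℂ (T → ℂ)}
    {Φ : T → SmoothGerm d} (h : Good R N Φ)
    (ℓ : ({w : List (Fin d) // w.length < N} → ℝ) →ₗ[ℝ] ℝ) :
    (fun t => (ℓ (jets d N (Φ t)) : ℂ)) ∈ R := by
  classical
  have : Fintype {w : List (Fin d) // w.length < N} := Fintype.ofFinite _
  have h1 : ∑ w : {w : List (Fin d) // w.length < N}, ((ℓ (Pi.single w 1) : ℝ) : ℂ) •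
      (fun t => (jet w.1 (Φ t) : ℂ)) ∈ R :=
    sum_mem fun w _ => Subalgebra.smul_mem _ (h w.1 w.2) _
  convert h1 using 1
  ext t
  rw [LinearMap.pi_apply_eq_sum_univ ℓ]
  simp only [Finset.sum_apply, Pi.smul_apply, smul_eq_mul, Complex.ofReal_sum, Complex.ofReal_mul]
  refine Finset.sum_congr rfl fun w _ => ?_
  rw [mul_comm]
  congr 3
  ext v
  simp [Pi.single_apply, eq_comm]

/-- Presents the jets of the ideal as a span over an index type independent of `F`, as
`exists_minors` requires. -/
theorem map_jets_eq_span {d N : ℕ} (I J : Ideal (SmoothGerm d)) (F : SelfMapGerm d) :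
    ((I.map (pullback F) ⊔ J).restrictScalars ℝ).map (jets d N) =
      Submodule.span ℝ (Set.range (Sum.elim
        (fun x : SmoothGerm d × I => jets d N (x.1 * pullback F x.2.1))
        (fun x : J => jets d N x.1))) := by
  apply le_antisymm
  · rw [Submodule.map_le_iff_le_comap]
    intro x hx
    obtain ⟨y, hy, z, hz, rfl⟩ := Submodule.mem_sup.1 hx
    rw [Submodule.mem_comap, map_add]
    refine add_mem ?_ (Submodule.subset_span ⟨Sum.inr ⟨z, hz⟩, rfl⟩)
    clear hx
    suffices h : ∀ a, jets d N (a * y) ∈ Submodule.span ℝ (Set.range (Sum.elim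
        (fun x : SmoothGerm d × I => jets d N (x.1 * pullback F x.2.1))
        (fun x : J => jets d N x.1))) by
      simpa using h 1
    induction hy using Submodule.span_induction with
    | mem y hy =>
      obtain ⟨f, hf, rfl⟩ := hy
      exact fun a => Submodule.subset_span ⟨Sum.inl (a, ⟨f, hf⟩), rfl⟩
    | zero => intro a; simp
    | add y z _ _ hy hz =>
      intro a
      rw [mul_add, map_add]
      exact add_mem (hy a) (hz a)
    | smul b y _ hy =>
      intro a
      rw [smul_eq_mul, ← mul_assoc]
      exact hy _
  · rw [Submodule.span_le]
    rintro _ ⟨x | x, rfl⟩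
    · exact ⟨_, Ideal.mem_sup_left (Ideal.mul_mem_left _ _ (Ideal.mem_map_of_mem _ x.2.2)), rfl⟩
    · exact ⟨_, Ideal.mem_sup_right x.2, rfl⟩

theorem exists_mult_bound {d : ℕ} {T : Type*} {X : Set (T → ℂ)} (hX : X.Finite)
    (Ψ : T → DiffGerm d) (hΨ : GoodMap (Algebra.adjoin ℂ X) fun t => (Ψ t).val)
    (I J : Ideal (SmoothGerm d)) :
    ∃ m : ℕ, ∀ t, mult I J (Ψ t) < ⊤ → mult I J (Ψ t) ≤ (m : ℕ∞) := by
  have := isNoetherianRing_adjoin hX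
  have hD : ∀ k : ℕ, ∃ D : Set (T → ℂ), D ⊆ Algebra.adjoin ℂ X ∧ ∀ t,
      t ∈ {t | mult I J (Ψ t) ≤ (k : ℕ∞)} ↔ ∃ f ∈ D, f t ≠ 0 := by
    intro k
    obtain ⟨D, hDR, hD⟩ := exists_minors (R := Algebra.adjoin ℂ X)
      (fun (i : (SmoothGerm d × I) ⊕ J) (t : T) => Sum.elim
        (fun x : SmoothGerm d × I => jets d (k + 1) (x.1 * pullback (Ψ t).val x.2.1))
        (fun x : J => jets d (k + 1) x.1) i)
      (fun ℓ i => by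
        rcases i with x | x
        · exact ((good_const x.1).mul ((good_const x.2.1).pullback (hΨ (k + 1)))).functional ℓ
        · exact (good_const x.1).functional ℓ)
      -- The rank that the jets must reach for the codimension to be at most `k`.
      (Module.finrank ℝ (SmoothGerm d ⧸ maxIdeal d ^ (k + 1)) - k)
    refine ⟨D, hDR, fun t => ?_⟩
    rw [← hD, ← map_jets_eq_span, ← codim_sup_pow_le_iff_finrank, codim_sup_pow_le_iff]
    rfl
  choose D hDR hD using hD
  obtain ⟨m, hm⟩ := exists_stable (fun k : ℕ => {t | mult I J (Ψ t) ≤ (k : ℕ∞)})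
    (fun k l hkl t (ht : _ ≤ _) => ht.trans (by exact_mod_cast hkl : (k : ℕ∞) ≤ l)) D hDR hD
  refine ⟨m, fun t ht => ?_⟩
  obtain ⟨k, hk⟩ := ENat.ne_top_iff_exists.1 ht.ne
  exact hm k hk.ge

/-! ### Parametrisation of finitely generated commutative groups -/

/-- The set `S` is covered by a family of germs of diffeomorphisms whose jets belong to a finitely
generated algebra of functions of the parameter. -/
def Parametrized {d : ℕ} {C : Type*} [Group C] (ι : C →* DiffGerm d) (S : Set C) : Prop :=
  ∃ (T : Type) (X : Set (T → ℂ)) (Ψ : T → C), X.Finite ∧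
    GoodMap (Algebra.adjoin ℂ X) (fun t => (ι (Ψ t)).val) ∧ S ⊆ Set.range Ψ

theorem comp_mem_adjoin {T T' : Type*} {X : Set (T → ℂ)} {X' : Set (T' → ℂ)} (π : T' → T)
    (h : ∀ f ∈ X, f ∘ π ∈ Algebra.adjoin ℂ X') {f : T → ℂ} (hf : f ∈ Algebra.adjoin ℂ X) :
    f ∘ π ∈ Algebra.adjoin ℂ X' := by
  induction hf using Algebra.adjoin_induction with
  | mem x hx => exact h x hx
  | algebraMap r => exact (Algebra.adjoin ℂ X').algebraMap_mem r
  | add x y _ _ hx hy => exact add_mem hx hy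
  | mul x y _ _ hx hy => exact mul_mem hx hy

theorem Parametrized.mono {d : ℕ} {C : Type*} [Group C] {ι : C →* DiffGerm d} {S S' : Set C}
    (h : Parametrized ι S) (hS : S' ⊆ S) : Parametrized ι S' := by
  obtain ⟨T, X, Ψ, hX, hg, hr⟩ := h
  exact ⟨T, X, Ψ, hX, hg, hS.trans hr⟩

open scoped Pointwise in
theorem Parametrized.mul {d : ℕ} {C : Type*} [Group C] {ι : C →* DiffGerm d} {S S' : Set C}
    (h : Parametrized ι S) (h' : Parametrized ι S') : Parametrized ι (S * S') := by
  obtain ⟨T, X, Ψ, hX, hg, hr⟩ := h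
  obtain ⟨T', X', Ψ', hX', hg', hr'⟩ := h'
  refine ⟨T × T', (fun f => f ∘ Prod.fst) '' X ∪ (fun f => f ∘ Prod.snd) '' X',
    fun t => Ψ t.1 * Ψ' t.2, (hX.image _).union (hX'.image _), ?_, ?_⟩
  · simp only [map_mul, Units.val_mul]
    exact (hg.comp fun f hf => comp_mem_adjoin Prod.fst (fun f hf => Algebra.subset_adjoin
        (Or.inl ⟨f, hf, rfl⟩)) hf).mul
      (hg'.comp fun f hf => comp_mem_adjoin Prod.snd (fun f hf => Algebra.subset_adjoin
        (Or.inr ⟨f, hf, rfl⟩)) hf)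
  · rintro _ ⟨a, ha, b, hb, rfl⟩
    obtain ⟨t, rfl⟩ := hr ha
    obtain ⟨t', rfl⟩ := hr' hb
    exact ⟨(t, t'), rfl⟩

theorem parametrized_one {d : ℕ} {C : Type*} [Group C] {ι : C →* DiffGerm d} :
    Parametrized ι ({1} : Set C) := by
  refine ⟨Unit, ∅, fun _ => 1, Set.finite_empty, ?_, by simp⟩
  simp only [map_one, Units.val_one]
  exact goodMap_one

/-- Commutativity enters here: the subgroup generated by `H` and `H'` is the product set. -/
theorem Parametrized.sup {d : ℕ} {C : Type*} [CommGroup C] {ι : C →* DiffGerm d}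
    {H H' : Subgroup C} (h : Parametrized ι (H : Set C)) (h' : Parametrized ι (H' : Set C)) :
    Parametrized ι ((H ⊔ H' : Subgroup C) : Set C) := by
  refine (h.mul h').mono fun x hx => ?_
  obtain ⟨y, hy, z, hz, rfl⟩ := Subgroup.mem_sup.1 hx
  exact ⟨y, hy, z, hz, rfl⟩

/-- The recurrence runs over `ℕ`, so integer powers are covered by products of natural powers of `f`
and of `f⁻¹`. -/
theorem parametrized_zpowers {d : ℕ} {C : Type*} [Group C] (ι : C →* DiffGerm d) (f : C) :
    Parametrized ι (Subgroup.zpowers f : Set C) := by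
  have key : ∀ f : C, Parametrized ι (Set.range fun n : ℕ => f ^ n) := fun f => by
    obtain ⟨X, hX, hg⟩ := exists_goodMap_pow (ι f)
    refine ⟨ℕ, X, fun n => f ^ n, hX, ?_, le_rfl⟩
    simpa only [map_pow] using hg
  refine ((key f).mul (key f⁻¹)).mono ?_
  rintro _ ⟨n, rfl⟩
  rcases n with n | n
  · exact ⟨f ^ n, ⟨n, rfl⟩, 1, ⟨0, pow_zero _⟩, by simp⟩
  · exact ⟨1, ⟨0, pow_zero _⟩, f⁻¹ ^ (n + 1), ⟨n + 1, rfl⟩, by simp⟩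

theorem exists_parametrized_of_generators {d : ℕ} {C : Type*} [CommGroup C] (ι : C →* DiffGerm d)
    {p q : ℕ} (f : Fin p → C) (φ : Fin q → Multiplicative ℝ →* C)
    (hφ : ∀ j, ∃ X : Set (ℝ → ℂ), X.Finite ∧
      GoodMap (Algebra.adjoin ℂ X) fun t => (ι (φ j (Multiplicative.ofAdd t))).val) :
    ∃ H : Subgroup C, (∀ i, f i ∈ H) ∧ (∀ j t, φ j t ∈ H) ∧ Parametrized ι (H : Set C) := by
  let H₁ : Subgroup C := Finset.univ.sup fun i => Subgroup.zpowers (f i)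
  let H₂ : Subgroup C := Finset.univ.sup fun j => (φ j).range
  have hbot : Parametrized ι ((⊥ : Subgroup C) : Set C) := by
    rw [Subgroup.coe_bot]; exact parametrized_one
  refine ⟨H₁ ⊔ H₂, fun i => ?_, fun j t => ?_, Parametrized.sup ?_ ?_⟩
  · exact (le_sup_left : H₁ ≤ H₁ ⊔ H₂) (Finset.le_sup (f := fun i => Subgroup.zpowers (f i))
      (Finset.mem_univ i) (Subgroup.mem_zpowers (f i)))
  · exact (le_sup_right : H₂ ≤ H₁ ⊔ H₂) (Finset.le_sup (f := fun j => (φ j).range)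
      (Finset.mem_univ j) ⟨t, rfl⟩)
  · exact Finset.sup_induction (p := fun H : Subgroup C => Parametrized ι (H : Set C)) hbot
      (fun _ h _ h' => h.sup h') fun i _ => parametrized_zpowers ι (f i)
  · refine Finset.sup_induction (p := fun H : Subgroup C => Parametrized ι (H : Set C)) hbot
      (fun _ h _ h' => h.sup h') fun j _ => ?_
    obtain ⟨X, hX, hg⟩ := hφ j
    refine ⟨ℝ, X, fun t => φ j (Multiplicative.ofAdd t), hX, hg, ?_⟩
    rintro _ ⟨t, rfl⟩
    exact ⟨t.toAdd, rfl⟩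

theorem parametrized_of_isFinitelyGenerated {d : ℕ} {G : Subgroup (DiffGerm d)}
    (hcomm : ∀ g ∈ G, ∀ h ∈ G, g * h = h * g) (hfin : IsFinitelyGenerated G) :
    Parametrized G.subtype Set.univ := by
  obtain ⟨p, q, F, v, hv, hG⟩ := hfin
  let _ : CommGroup G :=
    { (inferInstance : Group G) with
      mul_comm := fun a b => Subtype.ext (hcomm a a.2 b b.2) }
  choose Φ X hX hgood hflow hmem using fun j => exists_oneParameterGroup (hv j).1 (hv j).2
  have hgen : Set.range F ∪ {g | ∃ (j : Fin q) (t : ℝ), IsFlowMap (v j) t g} ⊆ G := by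
    rw [hG]; exact Subgroup.subset_closure
  have hΦ : ∀ j t, Φ j t ∈ G := by
    intro j t
    rcases hmem j t with h | ⟨s, h⟩
    · rw [h]; exact one_mem G
    · exact hgen (Or.inr ⟨j, s, h⟩)
  obtain ⟨H, hf, hφ, hH⟩ := exists_parametrized_of_generators G.subtype
    (fun i => (⟨F i, hgen (Or.inl ⟨i, rfl⟩)⟩ : G)) (fun j => (Φ j).codRestrict G (hΦ j))
    (fun j => ⟨X j, hX j, hgood j⟩)
  refine hH.mono fun g _ => ?_
  -- The parametrised subgroup contains all the generators, so it is everything.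
  have hle : G ≤ H.map G.subtype := by
    conv_lhs => rw [hG]
    rw [Subgroup.closure_le]
    rintro _ (⟨i, rfl⟩ | ⟨j, t, h⟩)
    · exact ⟨_, hf i, rfl⟩
    · exact ⟨_, hφ j (Multiplicative.ofAdd t), hflow j t _ h⟩
  obtain ⟨g', hg', h⟩ := hle g.2
  rwa [← Subtype.ext h]

theorem exists_mult_bound_subgroup {d : ℕ} {G : Subgroup (DiffGerm d)}
    (hcomm : ∀ g ∈ G, ∀ h ∈ G, g * h = h * g) (hfin : IsFinitelyGenerated G)
    (I J : Ideal (SmoothGerm d)) :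
    ∃ m : ℕ, ∀ g ∈ G, mult I J g < ⊤ → mult I J g ≤ (m : ℕ∞) := by
  obtain ⟨T, X, Ψ, hX, hg, hr⟩ := parametrized_of_isFinitelyGenerated hcomm hfin
  obtain ⟨m, hm⟩ := exists_mult_bound hX (fun t => (Ψ t : DiffGerm d)) hg I J
  refine ⟨m, fun g hgG => ?_⟩
  obtain ⟨t, ht⟩ := hr (Set.mem_univ (⟨g, hgG⟩ : G))
  have := hm t
  rwa [ht] at this

/-! ### Vanishing ideals -/

theorem pullback_mem_vanishingIdeal {d : ℕ} (F : SelfMapGerm d) {X : SetGerm d} {φ : SmoothGerm d}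
    (h : φ ∈ vanishingIdeal X) : pullback F φ ∈ vanishingIdeal (SelfMapGerm.compGerm X F) := by
  obtain ⟨f, hf, f0, rfl⟩ := exists_eq_toMapGerm F
  obtain ⟨u, hu, rfl⟩ := exists_eq_toGerm φ
  induction X using Germ.inductionOn with | _ X
  have h' : ∀ᶠ x in 𝓝 (0 : E d), X x → u x = 0 := h
  have ht : Tendsto f (𝓝 0) (𝓝 0) := (toMapGerm f hf f0).tendsto
  have h3 : ∀ᶠ x in 𝓝 (0 : E d), X (f x) → u (f x) = 0 := ht.eventually h'
  exact h3

theorem compGerm_mul {d : ℕ} {W : Type*} (X : Germ (𝓝 (0 : E d)) W) (F H : SelfMapGerm d) :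
    SelfMapGerm.compGerm (SelfMapGerm.compGerm X F) H = SelfMapGerm.compGerm X (F * H) := by
  obtain ⟨f, hf, f0, rfl⟩ := exists_eq_toMapGerm F
  obtain ⟨h, hh, h0, rfl⟩ := exists_eq_toMapGerm H
  induction X using Germ.inductionOn with | _ X
  rfl

theorem compGerm_one {d : ℕ} {W : Type*} (X : Germ (𝓝 (0 : E d)) W) :
    SelfMapGerm.compGerm X 1 = X := by
  induction X using Germ.inductionOn with | _ X
  rfl

/-- A germ vanishing on `g⁻¹(X)` is the pullback by `g` of its own pullback by the inverse of `g`,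
which vanishes on `X`. -/
theorem vanishingIdeal_preimage {d : ℕ} (g : DiffGerm d) (X : SetGerm d) :
    vanishingIdeal (preimage g X) = (vanishingIdeal X).map (pullback g.val) := by
  apply le_antisymm
  · intro φ hφ
    have h1 := pullback_mem_vanishingIdeal g.inv hφ
    rw [preimage, compGerm_mul, g.val_inv, compGerm_one] at h1
    have h2 := Ideal.mem_map_of_mem (pullback g.val) h1
    rwa [← pullback_mul, g.inv_val, pullback_one] at h2
  · exact Ideal.map_le_iff_le_comap.2 fun φ hφ => pullback_mem_vanishingIdeal g.val hφ

end SmoothLocal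

end

theorem mainTheorem3 (d : ℕ) (G : Subgroup (SmoothLocal.DiffGerm d))
    (hcomm : ∀ g ∈ G, ∀ h ∈ G, g * h = h * g)
    (hfin : SmoothLocal.IsFinitelyGenerated G) :
    (∀ I J : Ideal (SmoothLocal.SmoothGerm d), I.FG → J.FG →
      ∃ m : ℕ, ∀ g ∈ G, SmoothLocal.mult I J g < ⊤ → SmoothLocal.mult I J g ≤ (m : ℕ∞)) ∧
    (∀ X Y : SmoothLocal.SetGerm d,
      SmoothLocal.IsFinitelyPresented X → SmoothLocal.IsFinitelyPresented Y →
      ∃ m : ℕ, ∀ g ∈ G,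
        SmoothLocal.codim (SmoothLocal.vanishingIdeal (SmoothLocal.preimage g X) ⊔
            SmoothLocal.vanishingIdeal Y) < ⊤ →
        SmoothLocal.codim (SmoothLocal.vanishingIdeal (SmoothLocal.preimage g X) ⊔
            SmoothLocal.vanishingIdeal Y) ≤ (m : ℕ∞)) := by
  refine ⟨fun I J _ _ => SmoothLocal.exists_mult_bound_subgroup hcomm hfin I J,
    fun X Y _ _ => ?_⟩
  -- The second codimension becomes `mult` of two vanishing ideals, to which the bound for arbitrary
  -- ideals applies.
  simp only [SmoothLocal.vanishingIdeal_preimage]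
  exact SmoothLocal.exists_mult_bound_subgroup hcomm hfin _ _
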